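/- Let $\mathcal H$ be a finite-dimensional complex Hilbert space, let $\mathcal B(\mathcal H)$ be the algebra of linear operators on it, and let $\Phi:\mathcal B(\mathcal H)\to\mathcal B(\mathcal H)$ be a unital completely positive (UCP) map. Let $\mathrm{spect}_{\mathrm P}(\Phi)=\{\lambda\in\mathrm{spect}(\Phi) : |\lambda|=1\}$ be the peripheral spectrum of $\Phi$, let $$\mathrm{Attr}(\Phi)=\mathrm{span}\{X\in\mathcal B(\mathcal H) : \Phi(X)=\lambda X\text{ for some }\lambda\in\mathrm{spect}_{\mathrm P}(\Phi)\}$$ be its attractor subspace, and let $\mathcal P_{\mathrm P}=\sum_{\lambda\in\mathrm{spect}_{\mathrm P}(\Phi)}\mathcal P_\lambda$ be its peripheral projection, where $\mathcal P_\lambda$ is the spectral projection of $\Phi$ at $\lambda$ (the projection onto the generalized eigenspace of $\lambda$ along the sum of the other generalized eigenspaces). Let $\mathcal P_{\mathrm P}^\dagger$ be the adjoint of $\mathcal P_{\mathrm P}$ for the Hilbert-Schmidt scalar product $\langle A|B\rangle=\mathrm{tr}(A^*B)$. Put $\mathcal H_1=\ker(\mathcal P_{\mathrm P}^\dagger(\mathbb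 I))$ and $\mathcal H_0=\mathcal H_1^\perp$. Then there are an integer $M\ge 0$, non-zero Hilbert spaces $\mathcal H_{k,1}=\mathbb C^{d_k}$ and $\mathcal H_{k,2}=\mathbb C^{m_k}$ for $k=1,\dots,M$, and a unitary identification $\mathcal H_0=\bigoplus_{k=1}^M\mathcal H_{k,1}\otimes\mathcal H_{k,2}$, so that $$\mathcal H=\Big(\bigoplus_{k=1}^M\mathcal H_{k,1}\otimes\mathcal H_{k,2}\Big)\oplus\mathcal H_1,$$ and there is a UCP map $$\mathcal P_{11}:\mathfrak A\to\mathcal B(\mathcal H_1),\qquad \mathfrak A=\bigoplus_{k=1}^M\mathcal B(\mathcal H_{k,1})\otimes\mathbb C\,\mathbb I_{k,2}\subset\mathcal B(\mathcal H_0),$$ such that $$\mathrm{Attr}(\Phi)=\{X\oplus\mathcal P_{11}(X) : X\in\mathfrak A\}.$$ Moreover there are a permutation $\pi$ of $\{1,\dots,M\}$ with $d_k=d_{\pi(k)}$ for all $k$, and unitary operators $U_k$ on $\mathcal H_{k,1}$, such that for every $X=\bigoplus_{k=1}^M x_k\otimes\mathbb I_{k,2}\in\mathfrak A$ $$\Phi(X\oplus\mathcal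 P_{11}(X))=\phi_{00}(X)\oplus\mathcal P_{11}(\phi_{00}(X)),\qquad \phi_{00}(X)=\bigoplus_{k=1}^M U_{\pi(k)}^*x_{\pi(k)}U_{\pi(k)}\otimes\mathbb I_{k,2},$$ where $\mathcal B(\mathcal H_{\pi(k),1})$ is identified with $\mathcal B(\mathcal H_{k,1})$ through the standard bases of $\mathbb C^{d_{\pi(k)}}=\mathbb C^{d_k}$. -/

import Mathlib

open scoped TensorProduct CStarAlgebra

noncomputable section

namespace Asymptotics.UCP

section Spectral

variable {V : Type*} [AddCommGroup V] [Module ℂ V] [FiniteDimensional ℂ V]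

/-- The peripheral spectrum: the points of the spectrum of modulus one. -/
def peripheralSpectrum (T : Module.End ℂ V) : Set ℂ :=
  {μ | μ ∈ spectrum ℂ T ∧ ‖μ‖ = 1}

theorem peripheralSpectrum_finite (T : Module.End ℂ V) : (peripheralSpectrum T).Finite := by
  refine T.finite_hasEigenvalue.subset fun μ hμ => ?_
  exact Module.End.hasEigenvalue_iff_mem_spectrum.mpr hμ.1

/-- The attractor subspace: the span of the eigenvectors belonging to peripheral eigenvalues. -/
def attractor (T : Module.End ℂ V) : Submodule ℂ V :=
  Submodule.span ℂ {X | ∃ μ ∈ peripheralSpectrum T, T X = μ • X}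

theorem isCompl_maxGenEigenspace (T : Module.End ℂ V) (μ : ℂ) :
    IsCompl (T.maxGenEigenspace μ) (⨆ ν : ℂ, ⨆ _ : ν ≠ μ, T.maxGenEigenspace ν) := by
  refine ⟨T.independent_maxGenEigenspace μ, codisjoint_iff.mpr ?_⟩
  rw [eq_top_iff, ← T.iSup_maxGenEigenspace_eq_top]
  refine iSup_le fun ν => ?_
  by_cases h : ν = μ
  · subst h
    exact le_sup_left
  · exact le_sup_of_le_right (le_iSup₂_of_le ν h le_rfl)

/-- The spectral projection of `T` at `μ`: the projection onto the generalized eigenspace of `μ`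
along the sum of all the other generalized eigenspaces. -/
def spectralProjection (T : Module.End ℂ V) (μ : ℂ) : Module.End ℂ V :=
  Submodule.projection _ _ (isCompl_maxGenEigenspace T μ)

/-- The peripheral projection: the sum of the spectral projections over the peripheral
spectrum. -/
def peripheralProjection (T : Module.End ℂ V) : Module.End ℂ V :=
  ∑ μ ∈ (peripheralSpectrum_finite T).toFinset, spectralProjection T μ

end Spectral

section HilbertSchmidt

variable {H : Type*} [NormedAddCommGroup H] [InnerProductSpace ℂ H] [FiniteDimensional ℂ H]
  [CompleteSpace H]

/-- The Hilbert-Schmidt scalar product `tr (A⋆ B)`. -/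
def hsInner (A B : H →L[ℂ] H) : ℂ :=
  LinearMap.trace ℂ H (star A * B : H →L[ℂ] H).toLinearMap

/-- The Hilbert-Schmidt adjoint `T†` of a linear map `T` on `B(H)`, written out in the matrix units
`|eᵢ⟩⟨eⱼ|` of an orthonormal basis. It is the only map with
`⟨T†(A) | B⟩ = ⟨A | T(B)⟩` for all `A`, `B`; see `hsInner_hsAdjoint` and `eq_hsAdjoint`. -/
def hsAdjoint (T : Module.End ℂ (H →L[ℂ] H)) (A : H →L[ℂ] H) : H →L[ℂ] H :=
  ∑ i, ∑ j, hsInner (T (InnerProductSpace.rankOne ℂ (stdOrthonormalBasis ℂ H i)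
      (stdOrthonormalBasis ℂ H j))) A •
    InnerProductSpace.rankOne ℂ (stdOrthonormalBasis ℂ H i) (stdOrthonormalBasis ℂ H j)

theorem hsInner_eq_sum (A B : H →L[ℂ] H) :
    hsInner A B = ∑ i, inner ℂ (A (stdOrthonormalBasis ℂ H i)) (B (stdOrthonormalBasis ℂ H i)) := by
  rw [hsInner, LinearMap.trace_eq_sum_inner _ (stdOrthonormalBasis ℂ H)]
  refine Finset.sum_congr rfl fun i _ => ?_
  exact ContinuousLinearMap.adjoint_inner_right A _ _

theorem hsInner_rankOne_right (A : H →L[ℂ] H) (x y : H) :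
    hsInner A (InnerProductSpace.rankOne ℂ x y) = inner ℂ (A y) x := by
  have h : star A * InnerProductSpace.rankOne ℂ x y =
      InnerProductSpace.rankOne ℂ (star A x) y := by
    ext z
    simp
  rw [hsInner, h, InnerProductSpace.trace_rankOne]
  exact ContinuousLinearMap.adjoint_inner_right A _ _

theorem hsInner_conj (A B : H →L[ℂ] H) : (starRingEnd ℂ) (hsInner A B) = hsInner B A := by
  simp [hsInner_eq_sum, map_sum]

set_option linter.unusedSectionVars false in
theorem hsInner_sum_smul_right {ι : Type*} (s : Finset ι) (A : H →L[ℂ] H) (c : ι → ℂ)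
    (B : ι → H →L[ℂ] H) : hsInner A (∑ i ∈ s, c i • B i) = ∑ i ∈ s, c i * hsInner A (B i) := by
  simp only [hsInner, Finset.mul_sum, mul_smul_comm, ContinuousLinearMap.toLinearMap_sum,
    ContinuousLinearMap.toLinearMap_smul, map_sum, map_smul, smul_eq_mul]

theorem hsInner_hsAdjoint (T : Module.End ℂ (H →L[ℂ] H)) (A B : H →L[ℂ] H) :
    hsInner (hsAdjoint T A) B = hsInner A (T B) := by
  have hB : B = ∑ p : _ × _, inner ℂ (stdOrthonormalBasis ℂ H p.1)
      (B (stdOrthonormalBasis ℂ H p.2)) •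
      InnerProductSpace.rankOne ℂ (stdOrthonormalBasis ℂ H p.1) (stdOrthonormalBasis ℂ H p.2) := by
    rw [← ContinuousLinearMap.coe_inj]
    refine (stdOrthonormalBasis ℂ H).toBasis.ext fun k => ?_
    simp only [Fintype.sum_prod_type]
    rw [Finset.sum_comm]
    simp [orthonormal_iff_ite.mp (stdOrthonormalBasis ℂ H).orthonormal,
      (stdOrthonormalBasis ℂ H).sum_repr']
  have hT : T B = ∑ p : _ × _, inner ℂ (stdOrthonormalBasis ℂ H p.1)
      (B (stdOrthonormalBasis ℂ H p.2)) • T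
      (InnerProductSpace.rankOne ℂ (stdOrthonormalBasis ℂ H p.1)
        (stdOrthonormalBasis ℂ H p.2)) := by
    conv_lhs => rw [hB]
    rw [map_sum]
    exact Finset.sum_congr rfl fun p _ => map_smul _ _ _
  rw [← hsInner_conj, hsAdjoint, ← Fintype.sum_prod_type', hsInner_sum_smul_right, hT,
    hsInner_sum_smul_right, map_sum]
  refine Finset.sum_congr rfl fun p _ => ?_
  rw [map_mul, hsInner_conj, hsInner_rankOne_right, inner_conj_symm, mul_comm]

theorem eq_hsAdjoint (T : Module.End ℂ (H →L[ℂ] H)) (S : (H →L[ℂ] H) → (H →L[ℂ] H))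
    (hS : ∀ A B, hsInner (S A) B = hsInner A (T B)) : S = hsAdjoint T := by
  funext A
  ext y
  refine ext_inner_right ℂ fun x => ?_
  rw [← hsInner_rankOne_right, ← hsInner_rankOne_right, hS, hsInner_hsAdjoint]

/-- The subspace `H₁ = ker (P†(I))`, where `P` is the peripheral projection of `T`. -/
def transientSpace (T : Module.End ℂ (H →L[ℂ] H)) : Submodule ℂ H :=
  (hsAdjoint (peripheralProjection T) 1).ker

/-- Subspaces of a finite-dimensional Hilbert space are Hilbert spaces. -/
instance (T : Module.End ℂ (H →L[ℂ] H)) : CompleteSpace (transientSpace T) :=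
  FiniteDimensional.complete ℂ _

end HilbertSchmidt

section DirectSum

variable {H : Type*} [NormedAddCommGroup H] [InnerProductSpace ℂ H] [FiniteDimensional ℂ H]

/-- The operator `X ⊕ Y` on `H = Kᗮ ⊕ K`, for `X` in `B(Kᗮ)` and `Y` in `B(K)`. -/
def directSumOp (K : Submodule ℂ H) (X : Kᗮ →L[ℂ] Kᗮ) (Y : K →L[ℂ] K) : H →L[ℂ] H :=
  Kᗮ.subtypeL ∘L X ∘L Kᗮ.orthogonalProjectionOnto + K.subtypeL ∘L Y ∘L K.orthogonalProjectionOnto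

end DirectSum

section Blocks

variable {M : ℕ} (d m : Fin M → ℕ)

/-- The Hilbert space `⨁ₖ ℂ^{dₖ} ⊗ ℂ^{mₖ}`. -/
abbrev BlockSpace : Type :=
  PiLp 2 fun k => EuclideanSpace ℂ (Fin (d k)) ⊗[ℂ] EuclideanSpace ℂ (Fin (m k))

instance (a b : ℕ) : CompleteSpace (EuclideanSpace ℂ (Fin a) ⊗[ℂ] EuclideanSpace ℂ (Fin b)) :=
  FiniteDimensional.complete ℂ _

/-- The families `(xₖ)ₖ` with `xₖ` in `B(ℂ^{dₖ})`. -/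
abbrev BlockFamily : Type :=
  ∀ k, EuclideanSpace ℂ (Fin (d k)) →L[ℂ] EuclideanSpace ℂ (Fin (d k))

variable {d}

/-- The operator `⨁ₖ xₖ ⊗ I` on `⨁ₖ ℂ^{dₖ} ⊗ ℂ^{mₖ}`. -/
def blockOp (x : BlockFamily d) : BlockSpace d m →L[ℂ] BlockSpace d m :=
  (PiLp.continuousLinearEquiv 2 ℂ _).symm.toContinuousLinearMap ∘L
    (ContinuousLinearMap.pi fun k =>
      TensorProduct.mapL (x k) (ContinuousLinearMap.id ℂ (EuclideanSpace ℂ (Fin (m k)))) ∘L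
        PiLp.proj 2 _ k)

theorem blockOp_apply (x : BlockFamily d) (v : BlockSpace d m) (k : Fin M) :
    blockOp m x v k = TensorProduct.mapL (x k) (ContinuousLinearMap.id ℂ _) (v k) := rfl

/-- `x ↦ ⨁ₖ xₖ ⊗ I` as a homomorphism of star algebras. -/
def blockHom : BlockFamily d →⋆ₐ[ℂ] (BlockSpace d m →L[ℂ] BlockSpace d m) where
  toFun := blockOp m
  map_one' := by
    ext v k
    simp [blockOp_apply, ContinuousLinearMap.one_def]
  map_mul' x y := by
    ext v k
    have h : TensorProduct.mapL (x k * y k)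
        (ContinuousLinearMap.id ℂ (EuclideanSpace ℂ (Fin (m k)))) =
        TensorProduct.mapL (x k) (ContinuousLinearMap.id ℂ _) ∘L
          TensorProduct.mapL (y k) (ContinuousLinearMap.id ℂ _) := by
      rw [← TensorProduct.mapL_comp]; rfl
    rw [blockOp_apply, Pi.mul_apply, h]
    rfl
  map_zero' := by
    ext v k
    rw [blockOp_apply, Pi.zero_apply, TensorProduct.mapL_zero_left]
    rfl
  map_add' x y := by
    ext v k
    rw [blockOp_apply, Pi.add_apply, TensorProduct.mapL_add_left]
    rfl
  commutes' c := by
    ext v k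
    have h : algebraMap ℂ (BlockFamily d) c k = c • ContinuousLinearMap.id ℂ _ := by
      rw [Pi.algebraMap_apply, Algebra.algebraMap_eq_smul_one]; rfl
    rw [blockOp_apply, h, TensorProduct.mapL_smul_left, TensorProduct.mapL_id_id,
      Algebra.algebraMap_eq_smul_one]
    rfl
  map_star' x := by
    rw [ContinuousLinearMap.star_eq_adjoint, ContinuousLinearMap.eq_adjoint_iff]
    intro v w
    simp only [PiLp.inner_apply, blockOp_apply]
    refine Finset.sum_congr rfl fun k _ => ?_
    have h : TensorProduct.mapL (star (x k))
        (ContinuousLinearMap.id ℂ (EuclideanSpace ℂ (Fin (m k)))) =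
        (TensorProduct.mapL (x k) (ContinuousLinearMap.id ℂ _)).adjoint := by
      rw [TensorProduct.adjoint_mapL]
      congr 1
      exact (star_one (EuclideanSpace ℂ (Fin (m k)) →L[ℂ] EuclideanSpace ℂ (Fin (m k)))).symm
    rw [Pi.star_apply, h, ContinuousLinearMap.adjoint_inner_left]

variable {m} {K : Type*} [NormedAddCommGroup K] [InnerProductSpace ℂ K] [CompleteSpace K]

/-- The operator `⨁ₖ xₖ ⊗ I` on a Hilbert space `K` that is identified with
`⨁ₖ ℂ^{dₖ} ⊗ ℂ^{mₖ}` through a unitary `W`. -/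
def blockEmbed (W : BlockSpace d m ≃ₗᵢ[ℂ] K) : BlockFamily d →⋆ₐ[ℂ] (K →L[ℂ] K) :=
  (StarAlgEquiv.toStarAlgHom W.conjStarAlgEquiv).comp (blockHom m)

/-- The algebra `𝔄 = ⨁ₖ B(ℂ^{dₖ}) ⊗ ℂI` of all operators `⨁ₖ xₖ ⊗ I` in `B(K)`. -/
def blockAlgebra (W : BlockSpace d m ≃ₗᵢ[ℂ] K) : StarSubalgebra ℂ (K →L[ℂ] K) :=
  (blockEmbed W).range

/-- `⨁ₖ xₖ ⊗ I` as an element of `𝔄`. -/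
def blockElem (W : BlockSpace d m ≃ₗᵢ[ℂ] K) (x : BlockFamily d) : blockAlgebra W :=
  ⟨blockEmbed W x, x, rfl⟩

instance (W : BlockSpace d m ≃ₗᵢ[ℂ] K) : IsClosed (blockAlgebra W : Set (K →L[ℂ] K)) :=
  Submodule.closed_of_finiteDimensional
    (LinearMap.range ((blockEmbed W).toAlgHom.toLinearMap))

/-- For the order inherited from `B(K)`, the positive elements of `𝔄` are those of the
C⋆-algebra `𝔄`. -/
instance (W : BlockSpace d m ≃ₗᵢ[ℂ] K) : StarOrderedRing (blockAlgebra W) := by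
  have hle : ∀ x y : blockAlgebra W, x ≤ y ↔ (x : K →L[ℂ] K) ≤ y := fun _ _ => Iff.rfl
  refine StarOrderedRing.of_nonneg_iff' (fun {x y} h z => ?_) fun a => ⟨fun ha => ?_, ?_⟩
  · rw [hle] at h ⊢
    exact add_le_add_right h _
  · have ha' : (0 : K →L[ℂ] K) ≤ a := ha
    have hsa : IsSelfAdjoint a := Subtype.ext ha'.isSelfAdjoint
    have hsp : QuasispectrumRestricts a ContinuousMap.realToNNReal := by
      rw [quasispectrumRestricts_iff_spectrumRestricts, SpectrumRestricts.nnreal_iff]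
      intro x hx
      have hx' : (algebraMap ℝ ℂ x) ∈ spectrum ℂ (a : K →L[ℂ] K) := by
        rw [← StarSubalgebra.spectrum_eq]
        exact (spectrum.algebraMap_mem_iff ℂ).mpr hx
      exact spectrum_nonneg_of_nonneg ha' ((spectrum.algebraMap_mem_iff ℂ).mp hx')
    obtain ⟨s, hs₁, _, hs₂⟩ :=
      CFC.exists_sqrt_of_isSelfAdjoint_of_quasispectrumRestricts hsa hsp
    exact ⟨s, by rw [hs₁.star_eq, hs₂]⟩
  · rintro ⟨s, rfl⟩
    exact star_mul_self_nonneg (s : K →L[ℂ] K)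

/-- The family whose member at `k` is `U_{π(k)}⋆ x_{π(k)} U_{π(k)}`, where `B(ℂ^{d_{π(k)}})` is
identified with `B(ℂ^{dₖ})` through the standard bases. -/
def permConj (π : Equiv.Perm (Fin M)) (hπ : ∀ k, d k = d (π k))
    (U : ∀ k, unitary (EuclideanSpace ℂ (Fin (d k)) →L[ℂ] EuclideanSpace ℂ (Fin (d k))))
    (x : BlockFamily d) : BlockFamily d :=
  fun k => (LinearIsometryEquiv.piLpCongrLeft 2 ℂ ℂ (finCongr (hπ k).symm)).conjStarAlgEquiv
    (star (U (π k)).1 * x (π k) * (U (π k)).1)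

end Blocks

end Asymptotics.UCP

end

open Asymptotics.UCP

open Filter Topology

namespace Asymptotics.UCP

/-! ### Powers of a contraction and the peripheral projection. -/

section Contraction

variable {V : Type*} [NormedAddCommGroup V] [NormedSpace ℂ V] [FiniteDimensional ℂ V]
  {T : Module.End ℂ V}

/-! A unital completely positive map is a norm contraction, so its peripheral generalized
eigenspaces consist of eigenvectors, while the other generalized eigenspaces decay under iteration.
Since finitely many unimodular numbers return simultaneously near 1, the powers of `Φ` converge
along a suitable filter to the peripheral projection `P`
(`exists_tendsto_pow_peripheralProjection`). Hence `P` is itself unital, completely positive and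
idempotent, and the attractor is its set of fixed points.

The structure of that set is Choi-Effros theory. Let `K = ker P†(I)`. Then `P` kills the projection
onto `K` and is faithful on `Kᗮ`. With the identity `P (X⋆ P b) = P (X⋆ b)` for fixed `X`, this
shows that fixed points are block diagonal for `Kᗮ ⊕ K`, that their corners on `Kᗮ` form a star
algebra 𝔄 (`apply_mul_eq_on_orthogonal`), and that a fixed point is recovered from its corner by
applying `P` (`apply_cornerEmbed_conjAdjoint`). The map `P₁₁` reads off the other corner of the
recovered fixed point.

Minimal projections put 𝔄 in the form `⨁ B(ℂ^{dₖ}) ⊗ ℂI` (`exists_blockAlgebra_eq`). Finally `Φ` is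
asymptotically invertible on the attractor, which forces equality under `P` in the Kadison-Schwarz
inequality (`apply_star_mul_self_of_fixed`). So `Φ` induces a star automorphism of 𝔄, and such a map
permutes blocks of equal size and conjugates by unitaries (`exists_eq_permConj`). -/

theorem spectralProjection_apply_self (T : Module.End ℂ V) {μ : ℂ} {v : V}
    (hv : v ∈ T.maxGenEigenspace μ) : spectralProjection T μ v = v :=
  Submodule.projection_apply_left (isCompl_maxGenEigenspace T μ) ⟨v, hv⟩

theorem spectralProjection_apply_of_ne (T : Module.End ℂ V) {μ ν : ℂ} (h : ν ≠ μ) {v : V}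
    (hv : v ∈ T.maxGenEigenspace ν) : spectralProjection T μ v = 0 := by
  rw [spectralProjection, Submodule.projection_apply_eq_zero_iff]
  exact Submodule.mem_iSup_of_mem ν (Submodule.mem_iSup_of_mem h hv)

theorem peripheralProjection_apply_of_mem (T : Module.End ℂ V) {μ : ℂ}
    (hμ : μ ∈ peripheralSpectrum T) {v : V} (hv : v ∈ T.maxGenEigenspace μ) :
    peripheralProjection T v = v := by
  rw [peripheralProjection, LinearMap.sum_apply, Finset.sum_eq_single μ,
    spectralProjection_apply_self T hv]
  · intro ν _ h
    exact spectralProjection_apply_of_ne T h.symm hv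
  · intro h
    exact absurd ((peripheralSpectrum_finite T).mem_toFinset.mpr hμ) h

theorem peripheralProjection_apply_of_notMem (T : Module.End ℂ V) {μ : ℂ}
    (hμ : μ ∉ peripheralSpectrum T) {v : V} (hv : v ∈ T.maxGenEigenspace μ) :
    peripheralProjection T v = 0 := by
  rw [peripheralProjection, LinearMap.sum_apply]
  refine Finset.sum_eq_zero fun ν hν => ?_
  refine spectralProjection_apply_of_ne T (fun h => hμ ?_) hv
  rw [h]
  exact (peripheralSpectrum_finite T).mem_toFinset.mp hν

/-- A property that is stable under addition holds everywhere once it holds on the generalized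
eigenspaces. -/
theorem maxGenEigenspace_induction (T : Module.End ℂ V) {p : V → Prop}
    (h : ∀ μ, ∀ v ∈ T.maxGenEigenspace μ, p v) (hadd : ∀ v w, p v → p w → p (v + w)) (v : V) :
    p v := by
  have hv : v ∈ ⨆ μ, T.maxGenEigenspace μ := by
    rw [T.iSup_maxGenEigenspace_eq_top]; trivial
  exact Submodule.iSup_induction _ (motive := p) hv h (h 0 0 (zero_mem _)) hadd

omit [FiniteDimensional ℂ V] in
theorem norm_pow_apply_le (hT : ∀ v, ‖T v‖ ≤ ‖v‖) (n : ℕ) (v : V) : ‖(T ^ n) v‖ ≤ ‖v‖ := by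
  induction n with
  | zero => simp
  | succ n ih =>
    rw [pow_succ', Module.End.mul_apply]
    exact (hT _).trans ih

theorem norm_le_one_of_mem_spectrum (hT : ∀ v, ‖T v‖ ≤ ‖v‖) {μ : ℂ} (hμ : μ ∈ spectrum ℂ T) :
    ‖μ‖ ≤ 1 := by
  obtain ⟨v, hv⟩ := (Module.End.hasEigenvalue_iff_mem_spectrum.mpr hμ).exists_hasEigenvector
  have h := hT v
  rw [hv.apply_eq_smul, norm_smul] at h
  exact le_of_mul_le_mul_right (by simpa using h) (norm_pos_iff.mpr hv.2)

-- Induction on the nilpotency order. The norms of `T ^ n v` decrease to a limit `L`; as `(T - μ) v`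
-- has lower order, its orbit already tends to 0, so `L ≤ ‖μ‖ L` and `L = 0`.
omit [FiniteDimensional ℂ V] in
theorem tendsto_pow_of_norm_lt_one (hT : ∀ v, ‖T v‖ ≤ ‖v‖) {μ : ℂ} (hμ : ‖μ‖ < 1) {v : V}
    (hv : v ∈ T.maxGenEigenspace μ) : Tendsto (fun n => (T ^ n) v) atTop (𝓝 0) := by
  obtain ⟨k, hk⟩ := Module.End.mem_maxGenEigenspace T μ v |>.mp hv
  clear hv
  induction k generalizing v with
  | zero =>
    have : v = 0 := by simpa using hk
    simp [this]
  | succ k ih =>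
    rw [pow_succ, Module.End.mul_apply] at hk
    have hw := ih hk
    have hrec : ∀ n, (T ^ (n + 1)) v = μ • (T ^ n) v + (T ^ n) ((T - μ • 1) v) := by
      intro n
      rw [LinearMap.sub_apply, map_sub, LinearMap.smul_apply, Module.End.one_apply, map_smul,
        add_sub_cancel, pow_succ, Module.End.mul_apply]
    have hanti : Antitone fun n => ‖(T ^ n) v‖ := antitone_nat_of_succ_le fun n => by
      rw [pow_succ', Module.End.mul_apply]
      exact hT _
    have hL := tendsto_atTop_ciInf hanti ⟨0, by rintro _ ⟨n, rfl⟩; exact norm_nonneg _⟩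
    set L := ⨅ n, ‖(T ^ n) v‖
    have hL0 : 0 ≤ L := ge_of_tendsto' hL fun n => norm_nonneg _
    have h1 : L ≤ ‖μ‖ * L + 0 := by
      refine le_of_tendsto_of_tendsto' ((tendsto_add_atTop_iff_nat 1).mpr hL)
        ((hL.const_mul ‖μ‖).add (tendsto_zero_iff_norm_tendsto_zero.mp hw)) fun n => ?_
      rw [hrec, ← norm_smul]
      exact norm_add_le _ _
    have h2 : L = 0 := by nlinarith
    rw [h2] at hL
    exact tendsto_zero_iff_norm_tendsto_zero.mpr hL

-- A nontrivial Jordan block at a unimodular eigenvalue would make the powers grow linearly, which a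
-- contraction excludes.
omit [FiniteDimensional ℂ V] in
theorem apply_eq_smul_of_norm_eq_one (hT : ∀ v, ‖T v‖ ≤ ‖v‖) {μ : ℂ} (hμ : ‖μ‖ = 1) {v : V}
    (hv : v ∈ T.maxGenEigenspace μ) : T v = μ • v := by
  obtain ⟨k, hk⟩ := Module.End.mem_maxGenEigenspace T μ v |>.mp hv
  have key : ∀ u : V, (T - μ • 1) ((T - μ • 1) u) = 0 → (T - μ • 1) u = 0 := by
    intro u hu
    set w := (T - μ • 1) u with hw
    have hTu : T u = μ • u + w := by simp [hw]
    have hTw : T w = μ • w := by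
      rw [LinearMap.sub_apply] at hu
      simpa [sub_eq_zero] using hu
    -- At `n = 0` the exponent truncates to 0, harmlessly, because the factor `n` vanishes.
    have hpow : ∀ n : ℕ, (T ^ n) u = μ ^ n • u + (n * μ ^ (n - 1) : ℂ) • w := by
      intro n
      induction n with
      | zero => simp
      | succ n ih =>
        rw [pow_succ', Module.End.mul_apply, ih, map_add, map_smul, map_smul, hTu, hTw, smul_add,
          smul_smul, smul_smul, add_assoc, ← add_smul]
        cases n with
        | zero => simp
        | succ n =>
          simp only [Nat.add_sub_cancel, Nat.cast_succ]
          congr 2; ring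
    by_contra hne
    have hpos : 0 < ‖w‖ := norm_pos_iff.mpr hne
    obtain ⟨n, hn⟩ := exists_nat_gt (2 * ‖u‖ / ‖w‖)
    rw [div_lt_iff₀ hpos] at hn
    have h1 : ‖(n * μ ^ (n - 1) : ℂ) • w‖ ≤ 2 * ‖u‖ := by
      have : (n * μ ^ (n - 1) : ℂ) • w = (T ^ n) u - μ ^ n • u := by rw [hpow n]; abel
      rw [this]
      refine (norm_sub_le _ _).trans ?_
      rw [norm_smul, norm_pow, hμ, one_pow, one_mul, two_mul]
      gcongr
      exact norm_pow_apply_le hT n u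
    rw [norm_smul, norm_mul, norm_pow, hμ, one_pow, mul_one, Complex.norm_natCast] at h1
    linarith
  have hdown : ∀ k : ℕ, ((T - μ • 1) ^ (k + 1)) v = 0 → (T - μ • 1) v = 0 := by
    intro k
    induction k with
    | zero => simp
    | succ k ih =>
      intro h
      refine ih ?_
      rw [pow_succ', Module.End.mul_apply]
      refine key _ ?_
      rwa [pow_succ', Module.End.mul_apply, pow_succ', Module.End.mul_apply] at h
  have h0 : (T - μ • 1) v = 0 := by
    refine hdown k ?_
    rw [pow_succ', Module.End.mul_apply, hk, map_zero]
  simpa [sub_eq_zero] using h0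

/-- Along a suitable filter the powers of a contraction converge to its peripheral projection. -/
theorem exists_tendsto_pow_peripheralProjection (hT : ∀ v, ‖T v‖ ≤ ‖v‖) :
    ∃ F : Filter ℕ, F.NeBot ∧ F ≤ atTop ∧
      ∀ v, Tendsto (fun n => (T ^ n) v) F (𝓝 (peripheralProjection T v)) := by
  let g : peripheralSpectrum T → Circle := fun μ => ⟨μ.1, mem_sphere_zero_iff_norm.mpr μ.2.2⟩
  -- Powers of an element of a compact group come back near the identity. Using the torus indexed by
  -- the whole peripheral spectrum gives one ultrafilter for all eigenvalues at once.
  have hg : MapClusterPt 1 atTop (fun n : ℕ => g ^ n) := mapClusterPt_one_atTop_pow g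
  obtain ⟨U, hF, hFg⟩ := mapClusterPt_iff_ultrafilter.mp hg
  refine ⟨U, U.neBot, hF, maxGenEigenspace_induction T (fun μ v hv => ?_) fun v w hv hw => ?_⟩
  · by_cases hμ : μ ∈ peripheralSpectrum T
    · rw [peripheralProjection_apply_of_mem T hμ hv]
      have h1 := apply_eq_smul_of_norm_eq_one hT hμ.2 hv
      have h2 : ∀ n : ℕ, (T ^ n) v = μ ^ n • v := by
        intro n
        induction n with
        | zero => simp
        | succ n ih => rw [pow_succ, Module.End.mul_apply, h1, map_smul, ih, smul_smul, pow_succ']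
      have h3 : Tendsto (fun n : ℕ => μ ^ n) U (𝓝 1) := by
        have := (tendsto_pi_nhds.mp hFg) ⟨μ, hμ⟩
        exact (continuous_subtype_val.tendsto (1 : Circle)).comp this
      simpa [h2] using h3.smul_const v
    · rw [peripheralProjection_apply_of_notMem T hμ hv]
      by_cases hs : μ ∈ spectrum ℂ T
      · exact (tendsto_pow_of_norm_lt_one hT (lt_of_le_of_ne (norm_le_one_of_mem_spectrum hT hs)
          fun h => hμ ⟨hs, h⟩) hv).mono_left hF
      · have hv0 : v = 0 := by
          by_contra hne
          obtain ⟨k, hk⟩ := Module.End.mem_maxGenEigenspace T μ v |>.mp hv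
          have hu : IsUnit (T - μ • 1) := by
            have := (spectrum.notMem_iff.mp hs).neg
            rwa [neg_sub, Algebra.algebraMap_eq_smul_one] at this
          exact hne (((Module.End.isUnit_iff _).mp (hu.pow k)).injective (by simpa using hk))
        simp [hv0]
  · simpa using hv.add hw

theorem mem_attractor_iff (hT : ∀ v, ‖T v‖ ≤ ‖v‖) {v : V} :
    v ∈ attractor T ↔ peripheralProjection T v = v := by
  constructor
  · intro hv
    induction hv using Submodule.span_induction with
    | mem v hv =>
      obtain ⟨μ, hμ, h⟩ := hv
      refine peripheralProjection_apply_of_mem T hμ ?_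
      exact Module.End.mem_maxGenEigenspace T μ v |>.mpr ⟨1, by simp [h]⟩
    | zero => exact map_zero _
    | add v w _ _ hv hw => rw [map_add, hv, hw]
    | smul c v _ hv => rw [map_smul, hv]
  · intro h
    rw [← h]
    clear h
    induction v using maxGenEigenspace_induction T with
    | h μ v hv =>
      by_cases hμ : μ ∈ peripheralSpectrum T
      · rw [peripheralProjection_apply_of_mem T hμ hv]
        exact Submodule.subset_span ⟨μ, hμ, apply_eq_smul_of_norm_eq_one hT hμ.2 hv⟩
      · rw [peripheralProjection_apply_of_notMem T hμ hv]
        exact zero_mem _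
    | hadd v w hv hw => rw [map_add]; exact add_mem hv hw

theorem peripheralProjection_idem (T : Module.End ℂ V) (v : V) :
    peripheralProjection T (peripheralProjection T v) = peripheralProjection T v := by
  induction v using maxGenEigenspace_induction T with
  | h μ v hv =>
    by_cases hμ : μ ∈ peripheralSpectrum T
    · rw [peripheralProjection_apply_of_mem T hμ hv, peripheralProjection_apply_of_mem T hμ hv]
    · rw [peripheralProjection_apply_of_notMem T hμ hv, map_zero]
  | hadd v w hv hw => rw [map_add, map_add, hv, hw]

end Contraction

/-! ### Completely positive maps and the Kadison-Schwarz inequality. -/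

section CompletelyPositive

variable {A B : Type*} [CStarAlgebra A] [PartialOrder A] [StarOrderedRing A]
  [CStarAlgebra B] [PartialOrder B] [StarOrderedRing B]

theorem exists_eq_star_mul_self {C : Type*} [NonUnitalCStarAlgebra C] [PartialOrder C]
    [StarOrderedRing C] {a : C} (ha : 0 ≤ a) : ∃ b, a = star b * b :=
  CStarAlgebra.nonneg_iff_eq_star_mul_self.mp ha

/-- The matrix with entries `bᵢ⋆ bⱼ`. -/
def gramMatrix {n C : Type*} [Mul C] [Star C] (b : n → C) : CStarMatrix n n C :=
  CStarMatrix.ofMatrix (Matrix.of fun i j => star (b i) * b j)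

theorem gramMatrix_apply {n C : Type*} [Mul C] [Star C] (b : n → C) (i j : n) :
    gramMatrix b i j = star (b i) * b j := rfl

theorem cstarMatrix_sum_apply {ι m n C : Type*} [AddCommMonoid C] (s : Finset ι)
    (f : ι → CStarMatrix m n C) (i : m) (j : n) : (∑ k ∈ s, f k) i j = ∑ k ∈ s, f k i j := by
  classical
  induction s using Finset.induction with
  | empty => simp
  | insert k s hk ih => rw [Finset.sum_insert hk, Finset.sum_insert hk, CStarMatrix.add_apply, ih]

/-- Factoring `M = N⋆ N` turns the form into a sum of squares. -/
theorem cstarMatrix_form_nonneg {n : Type*} [Fintype n] {M : CStarMatrix n n A} (hM : 0 ≤ M)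
    (b : n → A) : 0 ≤ ∑ i, ∑ j, star (b i) * M i j * b j := by
  classical
  obtain ⟨N, rfl⟩ := exists_eq_star_mul_self hM
  have h : ∑ i, ∑ j, star (b i) * (star N * N) i j * b j =
      ∑ l, star (∑ i, N l i * b i) * ∑ j, N l j * b j := by
    simp only [CStarMatrix.mul_apply, CStarMatrix.star_apply, Finset.mul_sum, Finset.sum_mul,
      star_sum, star_mul, mul_assoc]
    rw [Finset.sum_comm' (t' := Finset.univ) (s' := fun _ => Finset.univ) (by simp)]
    conv_lhs => enter [2, j]; rw [Finset.sum_comm]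
    rw [Finset.sum_comm]
  rw [h]
  exact Finset.sum_nonneg fun l _ => star_mul_self_nonneg _

theorem gramMatrix_nonneg {n : Type*} [Fintype n] (b : n → A) : 0 ≤ gramMatrix b := by
  classical
  rcases isEmpty_or_nonempty n with h | ⟨⟨l⟩⟩
  · exact le_of_eq (by ext i; exact h.elim i)
  -- The family `b` is placed in a single row `l`, the other rows being zero.
  · let N : CStarMatrix n n A := CStarMatrix.ofMatrix (Matrix.of fun k j => if k = l then b j else 0)
    have hN : ∀ k j, N k j = if k = l then b j else 0 := fun _ _ => rfl
    have h : gramMatrix b = star N * N := by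
      ext i j
      simp only [CStarMatrix.mul_apply, CStarMatrix.star_apply, gramMatrix_apply, hN]
      rw [Finset.sum_eq_single l]
      · simp
      · intro k _ hk; simp [hk]
      · simp
    rw [h]
    exact star_mul_self_nonneg _

/-- The Kadison-Schwarz inequality. -/
theorem kadison_schwarz (φ : A →CP B) (h1 : φ 1 = 1) (x : A) :
    star (φ x) * φ x ≤ φ (star x * x) := by
  have hpos := φ.map_cstarMatrix_nonneg _ (gramMatrix_nonneg ![1, x])
  have hs : φ (star x) = star (φ x) := map_star φ x
  -- This vector makes the form of the image of the Gram matrix of `(1, x)` equal to `φ (x⋆ x) - (φ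
  -- x)⋆ φ x`.
  have h := cstarMatrix_form_nonneg hpos ![-φ x, 1]
  simp only [Fin.sum_univ_two, CStarMatrix.map_apply, gramMatrix_apply] at h
  simp [h1, hs] at h
  simpa using h

theorem norm_apply_le_of_unital (φ : A →CP B) (h1 : φ 1 = 1) (x : A) : ‖φ x‖ ≤ ‖x‖ := by
  have h := kadison_schwarz φ h1 x
  have h2 : φ (star x * x) ≤ φ (algebraMap ℝ A (‖x‖ ^ 2)) := by
    refine OrderHomClass.mono φ ?_
    simpa [CStarRing.norm_star_mul_self, sq] using
      (IsSelfAdjoint.star_mul_self x).le_algebraMap_norm_self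
  have h3 : φ (algebraMap ℝ A (‖x‖ ^ 2)) = algebraMap ℝ B (‖x‖ ^ 2) := by
    have : algebraMap ℝ A (‖x‖ ^ 2) = ((‖x‖ ^ 2 : ℝ) : ℂ) • (1 : A) := by
      rw [Algebra.algebraMap_eq_smul_one]; exact (Complex.coe_smul _ _).symm
    rw [this, map_smul, h1, Algebra.algebraMap_eq_smul_one]
    exact Complex.coe_smul _ _
  have h4 := h.trans (h2.trans_eq h3)
  have h5 : ‖star (φ x) * φ x‖ ≤ ‖x‖ ^ 2 :=
    (CStarAlgebra.norm_le_iff_le_algebraMap _ (by positivity) (star_mul_self_nonneg _)).mpr h4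
  rw [CStarRing.norm_star_mul_self, ← sq] at h5
  exact (sq_le_sq₀ (norm_nonneg _) (norm_nonneg _)).mp h5

theorem exists_pow_completelyPositive (φ : A →CP A) (n : ℕ) :
    ∃ ψ : A →CP A, ψ.toLinearMap = φ.toLinearMap ^ n := by
  induction n with
  | zero => exact ⟨⟨1, fun k M hM => hM⟩, rfl⟩
  | succ n ih =>
    obtain ⟨ψ, hψ⟩ := ih
    refine ⟨⟨φ.toLinearMap ^ (n + 1), fun k M hM => ?_⟩, rfl⟩
    have := φ.map_cstarMatrix_nonneg' k _ (ψ.map_cstarMatrix_nonneg' k M hM)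
    rw [pow_succ', ← hψ]
    exact this

/-- The topology on matrices is the entrywise one and the cone of positive matrices is closed. -/
theorem exists_completelyPositive_of_tendsto {ι : Type*} {F : Filter ι} [F.NeBot]
    {φ : ι → A →CP B} {T : A →ₗ[ℂ] B} (h : ∀ x, Tendsto (fun n => φ n x) F (𝓝 (T x))) :
    ∃ ψ : A →CP B, ψ.toLinearMap = T := by
  refine ⟨⟨T, fun k M hM => ?_⟩, rfl⟩
  have ht : Tendsto (fun n => M.map (φ n)) F (𝓝 (M.map T)) :=
    tendsto_pi_nhds.mpr fun i => tendsto_pi_nhds.mpr fun j => h (M i j)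
  exact ge_of_tendsto' ht fun n => (φ n).map_cstarMatrix_nonneg' k M hM

end CompletelyPositive

/-! ### Complete positivity of compressions. -/

section Compression

variable {H K : Type*} [NormedAddCommGroup H] [InnerProductSpace ℂ H] [FiniteDimensional ℂ H]
  [CompleteSpace H] [NormedAddCommGroup K] [InnerProductSpace ℂ K] [CompleteSpace K]

/-- The linear map `Y ↦ V⋆ Y V`. -/
noncomputable def conjAdjoint (V : K →L[ℂ] H) : (H →L[ℂ] H) →ₗ[ℂ] (K →L[ℂ] K) where
  toFun Y := V.adjoint ∘L Y ∘L V
  map_add' Y Z := by ext v; simp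
  map_smul' c Y := by ext v; simp

/-- After factoring `M = N⋆ N`, the operators `N l j ∘ V` go from `K` to `H` and are not elements of
`B(K)`. Inserting the resolution of the identity by the basis `e` and routing each rank-one piece
through a fixed unit vector of `K` gives a sum of Gram matrices over `B(K)`. -/
theorem map_conjAdjoint_nonneg (V : K →L[ℂ] H) {n : Type*} [Fintype n]
    {M : CStarMatrix n n (H →L[ℂ] H)} (hM : 0 ≤ M) : 0 ≤ M.map (conjAdjoint V) := by
  classical
  rcases subsingleton_or_nontrivial K with hK | hK
  · have : Subsingleton (K →L[ℂ] K) := ⟨fun f g => by ext v; exact Subsingleton.elim _ _⟩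
    exact le_of_eq (Subsingleton.elim _ _)
  obtain ⟨h, hh⟩ := exists_norm_eq K zero_le_one
  obtain ⟨N, rfl⟩ := exists_eq_star_mul_self hM
  let e := stdOrthonormalBasis ℂ H
  let b : n → _ → n → (K →L[ℂ] K) := fun l r j =>
    InnerProductSpace.rankOne ℂ h (V.adjoint (star (N l j) (e r)))
  have key : (star N * N).map (conjAdjoint V) =
      ∑ l, ∑ r, gramMatrix (b l r) := by
    refine CStarMatrix.ext fun i j => ContinuousLinearMap.ext fun v => ?_
    have h1 : ∀ l r, (star (b l r i) * b l r j) v =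
        V.adjoint (star (N l i) (inner ℂ (e r) (N l j (V v)) • e r)) := by
      intro l r
      have hs : star (b l r i) =
          InnerProductSpace.rankOne ℂ (V.adjoint (star (N l i) (e r))) h :=
        InnerProductSpace.adjoint_rankOne _ _
      rw [hs]
      simp only [b, mul_apply_eq_comp, InnerProductSpace.rankOne_apply, map_smul,
        ContinuousLinearMap.adjoint_inner_left, ContinuousLinearMap.star_eq_adjoint,
        inner_self_eq_norm_sq_to_K, hh]
      simp
    have h2 : ∀ l, ∑ r, (star (b l r i) * b l r j) v =
        V.adjoint (star (N l i) (N l j (V v))) := by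
      intro l
      simp only [h1]
      rw [← map_sum, ← map_sum, e.sum_repr']
    rw [cstarMatrix_sum_apply, sum_apply]
    simp only [cstarMatrix_sum_apply, sum_apply, gramMatrix_apply, h2,
      CStarMatrix.map_apply, CStarMatrix.mul_apply, CStarMatrix.star_apply]
    simp [conjAdjoint]
  rw [key]
  exact Finset.sum_nonneg fun l _ => Finset.sum_nonneg fun r _ => gramMatrix_nonneg _

end Compression

/-! ### The trace form and the support of `P†(I)`. -/

section HilbertSchmidt

variable {H : Type*} [NormedAddCommGroup H] [InnerProductSpace ℂ H] [FiniteDimensional ℂ H]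
  [CompleteSpace H]

theorem hsInner_one_star_mul_self (S : H →L[ℂ] H) :
    hsInner 1 (star S * S) = ∑ i, (‖S (stdOrthonormalBasis ℂ H i)‖ ^ 2 : ℂ) := by
  rw [hsInner_eq_sum]
  refine Finset.sum_congr rfl fun i _ => ?_
  rw [mul_apply_eq_comp, ContinuousLinearMap.star_eq_adjoint,
    ContinuousLinearMap.adjoint_inner_right]
  simp [inner_self_eq_norm_sq_to_K]

theorem hsInner_one_nonneg {A : H →L[ℂ] H} (hA : 0 ≤ A) : ∃ r : ℝ, 0 ≤ r ∧ hsInner 1 A = r := by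
  obtain ⟨S, rfl⟩ := exists_eq_star_mul_self hA
  refine ⟨∑ i, ‖S (stdOrthonormalBasis ℂ H i)‖ ^ 2, by positivity, ?_⟩
  rw [hsInner_one_star_mul_self]
  push_cast; rfl

theorem eq_zero_of_hsInner_one_star_mul_self {S : H →L[ℂ] H} (h : hsInner 1 (star S * S) = 0) :
    S = 0 := by
  rw [hsInner_one_star_mul_self] at h
  have h' : ∑ i, ‖S (stdOrthonormalBasis ℂ H i)‖ ^ 2 = 0 := by exact_mod_cast h
  rw [Finset.sum_eq_zero_iff_of_nonneg fun i _ => by positivity] at h'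
  rw [← ContinuousLinearMap.coe_inj]
  refine (stdOrthonormalBasis ℂ H).toBasis.ext fun i => ?_
  simpa using h' i (Finset.mem_univ i)

theorem eq_zero_of_nonneg_of_hsInner_one {A : H →L[ℂ] H} (hA : 0 ≤ A) (h : hsInner 1 A = 0) :
    A = 0 := by
  obtain ⟨S, rfl⟩ := exists_eq_star_mul_self hA
  rw [eq_zero_of_hsInner_one_star_mul_self h, mul_zero]

omit [FiniteDimensional ℂ H] in
theorem hsInner_one_mul_comm (A B : H →L[ℂ] H) : hsInner 1 (A * B) = hsInner 1 (B * A) := by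
  simp only [hsInner, star_one, one_mul]
  exact LinearMap.trace_mul_comm ℂ (A : H →ₗ[ℂ] H) B

omit [FiniteDimensional ℂ H] in
theorem hsInner_eq_one_star_mul (A B : H →L[ℂ] H) : hsInner A B = hsInner 1 (star A * B) := by
  simp [hsInner]

variable (P : (H →L[ℂ] H) →CP (H →L[ℂ] H))

theorem hsAdjoint_one_nonneg : 0 ≤ hsAdjoint P.toLinearMap 1 := by
  rw [ContinuousLinearMap.nonneg_iff_isPositive, ContinuousLinearMap.isPositive_iff_complex]
  intro x
  have hpos : 0 ≤ InnerProductSpace.rankOne ℂ x x := by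
    rw [ContinuousLinearMap.nonneg_iff_isPositive]
    exact InnerProductSpace.isPositive_rankOne_self x
  obtain ⟨r, hr, h⟩ := hsInner_one_nonneg (map_nonneg P hpos)
  have h2 : inner ℂ (hsAdjoint P.toLinearMap 1 x) x = r := by
    rw [← hsInner_rankOne_right, hsInner_hsAdjoint]
    exact h
  rw [h2]
  simpa using hr

/-- A completely positive map kills the projection onto the kernel of `P†(I)`. -/
theorem apply_starProjection_ker_hsAdjoint :
    P (hsAdjoint P.toLinearMap 1).ker.starProjection = 0 := by
  set R := hsAdjoint P.toLinearMap 1 with hR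
  refine eq_zero_of_nonneg_of_hsInner_one (map_nonneg P ?_) ?_
  · exact isStarProjection_starProjection.nonneg
  -- The trace of the image of the projection is the trace of `R` times the projection, and that
  -- product is zero.
  · have h : R * R.ker.starProjection = 0 := by
      ext x
      exact R.ker.starProjection_apply_mem x
    have h2 := hsInner_hsAdjoint P.toLinearMap 1 R.ker.starProjection
    rw [← hR, hsInner_eq_one_star_mul R, (hsAdjoint_one_nonneg P).isSelfAdjoint.star_eq, h] at h2
    exact h2.symm.trans (by simp [hsInner])

/-- A completely positive map is faithful off the kernel of `P†(I)`. -/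
theorem apply_eq_zero_of_apply_star_mul_self {W : H →L[ℂ] H} (hW : P (star W * W) = 0) {x : H}
    (hx : x ∈ ((hsAdjoint P.toLinearMap 1).ker)ᗮ) : W x = 0 := by
  set R := hsAdjoint P.toLinearMap 1 with hR
  obtain ⟨S, hS⟩ := exists_eq_star_mul_self (hsAdjoint_one_nonneg P)
  rw [← hR] at hS
  have h2 := hsInner_hsAdjoint P.toLinearMap 1 (star W * W)
  have h3 : hsInner 1 (P.toLinearMap (star W * W)) = 0 := by
    refine Eq.trans (congrArg _ hW) (by simp [hsInner])
  rw [h3, ← hR, hsInner_eq_one_star_mul R, (hsAdjoint_one_nonneg P).isSelfAdjoint.star_eq,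
    ← hR, hS] at h2
  -- By cyclicity of the trace, `h2` says that `S W⋆` has Hilbert-Schmidt norm zero. Hence `W⋆` maps
  -- into `ker R`, and `W` vanishes on the orthogonal complement.
  have h4 : S * star W = 0 := by
    refine eq_zero_of_hsInner_one_star_mul_self ?_
    rw [← h2, star_mul, star_star, mul_assoc, hsInner_one_mul_comm]
    simp only [mul_assoc]
  have h5 : ∀ y, star W y ∈ R.ker := by
    intro y
    have : (R * star W) y = 0 := by rw [hS, mul_assoc, h4]; simp
    exact this
  refine ext_inner_right ℂ fun y => ?_
  rw [← ContinuousLinearMap.adjoint_inner_right, inner_zero_left]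
  exact Submodule.inner_left_of_mem_orthogonal (h5 y) hx

end HilbertSchmidt

/-! ### Choi-Effros identities for a unital completely positive idempotent. -/

section ChoiEffros

variable {H : Type*} [NormedAddCommGroup H] [InnerProductSpace ℂ H] [CompleteSpace H]

/-- The quadratic form at a vector is real-affine in `t`, so it can stay nonnegative only if its
linear part vanishes. This extracts the cross term of a positive sesquilinear expression. -/
theorem eq_zero_of_forall_nonneg_add {E C : H →L[ℂ] H}
    (h : ∀ t : ℂ, 0 ≤ E + (starRingEnd ℂ t • C + t • star C)) : C = 0 := by
  rw [← ContinuousLinearMap.coe_inj]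
  refine (inner_map_self_eq_zero _).mp fun x => ?_
  set c := inner ℂ (C x) x with hc
  have hre : ∀ s : ℝ, 0 ≤ (inner ℂ (E x) x).re + s * (2 * ‖c‖ ^ 2) := by
    intro s
    have h1 := ((ContinuousLinearMap.nonneg_iff_isPositive _).mp (h ((s : ℂ) * starRingEnd ℂ c))).2 x
    have h2 : inner ℂ ((star C) x) x = starRingEnd ℂ c := by
      rw [ContinuousLinearMap.star_eq_adjoint, ContinuousLinearMap.adjoint_inner_left, hc,
        inner_conj_symm]
    have h3 : (s : ℂ) * starRingEnd ℂ c * c + s * c * starRingEnd ℂ c =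
        ((s * (2 * ‖c‖ ^ 2) : ℝ) : ℂ) := by
      have := Complex.conj_mul' c
      push_cast
      linear_combination 2 * s * this
    rw [ContinuousLinearMap.reApplyInnerSelf_apply, add_apply, add_apply, smul_apply, smul_apply,
      inner_add_left, inner_add_left, inner_smul_left, inner_smul_left, h2, ← hc] at h1
    simp only [map_mul, Complex.conj_ofReal, Complex.conj_conj, h3, RCLike.re_to_complex,
      Complex.add_re, Complex.ofReal_re] at h1
    exact h1
  by_contra hne
  have hpos : 0 < 2 * ‖c‖ ^ 2 := by have := norm_pos_iff.mpr hne; positivity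
  -- With this `s` the lower bound evaluates to `-1`.
  have h2 := hre (-((inner ℂ (E x) x).re + 1) / (2 * ‖c‖ ^ 2))
  rw [div_mul_cancel₀ _ hpos.ne'] at h2
  linarith

variable (P : (H →L[ℂ] H) →CP (H →L[ℂ] H)) (h1 : P 1 = 1) (hP : ∀ x, P (P x) = P x)
include h1 hP

/-- Kadison-Schwarz followed by `P` makes the defect `G` nonnegative. Since `G X = 0`, the term in
`|t|²` disappears from `G (b + t X)`, so the cross term must be zero. -/
theorem apply_star_mul_apply {X : H →L[ℂ] H} (hX : P X = X) (b : H →L[ℂ] H) :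
    P (star X * P b) = P (star X * b) := by
  let G : (H →L[ℂ] H) → (H →L[ℂ] H) := fun a => P (star a * a) - P (star (P a) * P a)
  have hG : ∀ a, 0 ≤ G a := by
    intro a
    have := map_nonneg P (sub_nonneg.mpr (kadison_schwarz P h1 a))
    rwa [map_sub, hP] at this
  have h0 : P (star X * b) - P (star X * P b) = 0 := by
    refine eq_zero_of_forall_nonneg_add (E := G b) fun t => ?_
    have h := hG (b + t • X)
    have hs : star (P (star X * b) - P (star X * P b)) =
        P (star b * X) - P (star (P b) * X) := by
      rw [star_sub, ← map_star, ← map_star]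
      simp
    rw [hs]
    convert h using 1
    simp only [G, map_add, map_smul, hX, star_add, star_smul, add_mul, mul_add, smul_mul_assoc,
      mul_smul_comm, smul_add, smul_sub, starRingEnd_apply]
    abel
  exact (sub_eq_zero.mp h0).symm

theorem apply_mul_apply_left {X : H →L[ℂ] H} (hX : P X = X) (b : H →L[ℂ] H) :
    P (P b * X) = P (b * X) := by
  have h := congrArg star (apply_star_mul_apply P h1 hP hX (star b))
  rw [← map_star, ← map_star] at h
  simpa [map_star] using h

variable {K : Submodule ℂ H} [K.HasOrthogonalProjection] (hK : P K.starProjection = 0)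
  (hfaithful : ∀ W : H →L[ℂ] H, P (star W * W) = 0 → ∀ x ∈ Kᗮ, W x = 0)

include hK in
theorem apply_starProjection_mul {X : H →L[ℂ] H} (hX : P X = X) :
    P (K.starProjection * X) = 0 := by
  rw [← apply_mul_apply_left P h1 hP hX, hK, zero_mul, map_zero]

include hK hfaithful

/-- With `Q` the projection onto `K`, `P (Q X) = P (P Q X) = 0`, so `P ((Q X)⋆ (Q X)) = P (X⋆ P (Q
X)) = 0`, and faithfulness kills `Q X` on `Kᗮ`. -/
theorem apply_mem_orthogonal {X : H →L[ℂ] H} (hX : P X = X) {x : H} (hx : x ∈ Kᗮ) :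
    X x ∈ Kᗮ := by
  have h := hfaithful (K.starProjection * X) (by
    rw [star_mul, isStarProjection_starProjection.isSelfAdjoint.star_eq, mul_assoc,
      ← mul_assoc K.starProjection, isStarProjection_starProjection.isIdempotentElem.eq, ← apply_star_mul_apply P h1 hP hX,
      apply_starProjection_mul P h1 hP hK hX, mul_zero, map_zero]) x hx
  exact (Submodule.starProjection_apply_eq_zero_iff K).mp h

theorem apply_mem {X : H →L[ℂ] H} (hX : P X = X) {x : H} (hx : x ∈ K) : X x ∈ K := by
  rw [← K.orthogonal_orthogonal]
  intro y hy
  have hX' : P (star X) = star X := by rw [map_star, hX]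
  rw [← ContinuousLinearMap.adjoint_inner_left]
  exact Submodule.inner_left_of_mem_orthogonal hx
    (apply_mem_orthogonal P h1 hP hK hfaithful hX' hy)

-- All four terms of `P ((Z - X Y)⋆ (Z - X Y))` with `Z = P (X Y)` reduce to `P (Y⋆ X⋆ X Y)` and
-- cancel; faithfulness concludes.
omit [K.HasOrthogonalProjection] hK in
theorem apply_mul_eq_on_orthogonal {X Y : H →L[ℂ] H} (hX : P X = X) (hY : P Y = Y) {x : H}
    (hx : x ∈ Kᗮ) : P (X * Y) x = X (Y x) := by
  have hX' : P (star X) = star X := by rw [map_star, hX]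
  have hY' : P (star Y) = star Y := by rw [map_star, hY]
  set Z := P (X * Y) with hZ
  have hZs : star Z = P (star Y * star X) := by rw [hZ, ← map_star, star_mul]
  have e1 : P (star Z * (X * Y)) = P (star Y * star X * X * Y) := by
    rw [← mul_assoc, ← apply_mul_apply_left P h1 hP hY, hZs, apply_mul_apply_left P h1 hP hX,
      apply_mul_apply_left P h1 hP hY]
  have e2 : P (star Y * star X * Z) = P (star Y * star X * X * Y) := by
    rw [mul_assoc, ← apply_star_mul_apply P h1 hP hY, hZ, apply_star_mul_apply P h1 hP hX,
      apply_star_mul_apply P h1 hP hY]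
    simp only [mul_assoc]
  have e3 : P (star Z * Z) = P (star Z * (X * Y)) := by
    have hZP : P Z = Z := by rw [hZ, hP]
    rw [hZ, apply_star_mul_apply P h1 hP]
    rw [← hZ, hZP]
  have h := hfaithful (Z - X * Y) (by
    rw [star_sub, sub_mul, mul_sub, mul_sub, map_sub, map_sub, map_sub, e3, star_mul, e2, e1,
      sub_self, zero_sub, ← mul_assoc (star Y * star X), sub_self, neg_zero]) x hx
  rw [sub_apply, sub_eq_zero] at h
  exact h

end ChoiEffros

/-! ### Multiplicativity of `Φ` on the fixed points of `P`. -/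

section Dynamics

variable {H : Type*} [NormedAddCommGroup H] [InnerProductSpace ℂ H] [CompleteSpace H]

theorem continuous_of_unital (Φ : (H →L[ℂ] H) →CP (H →L[ℂ] H)) (hΦ : Φ 1 = 1) : Continuous Φ :=
  AddMonoidHomClass.continuous_of_bound Φ 1 fun X => by
    simpa using norm_apply_le_of_unital Φ hΦ X

variable (Φ P : (H →L[ℂ] H) →CP (H →L[ℂ] H))
  {F : Filter ℕ} [F.NeBot] (hF : F ≤ atTop)
  (hlim : ∀ X, Tendsto (fun n => (Φ.toLinearMap ^ n) X) F (𝓝 (P X)))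

include hF hlim in
theorem eq_zero_of_apply_eq_zero {X : H →L[ℂ] H} (hX : P X = X) (h : Φ X = 0) : X = 0 := by
  rw [← hX]
  refine tendsto_nhds_unique (hlim X) (tendsto_const_nhds.congr' ?_)
  filter_upwards [hF (eventually_ge_atTop 1)] with n hn
  obtain ⟨m, rfl⟩ := Nat.exists_eq_add_of_le' hn
  have : (Φ.toLinearMap ^ (m + 1)) X = (Φ.toLinearMap ^ m) (Φ X) := by rw [pow_succ]; rfl
  rw [this, h, map_zero]

variable (hΦ : Φ 1 = 1)
include hΦ hlim

theorem apply_apply_comm (X : H →L[ℂ] H) : P (Φ X) = Φ (P X) := by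
  refine tendsto_nhds_unique (hlim (Φ X)) ?_
  have h := ((continuous_of_unital Φ hΦ).tendsto _).comp (hlim X)
  refine h.congr fun n => ?_
  change (Φ.toLinearMap * Φ.toLinearMap ^ n) X = (Φ.toLinearMap ^ n * Φ.toLinearMap) X
  rw [← pow_succ, ← pow_succ']

variable (hP : ∀ X, P (P X) = P X)
include hF hP

/-- The Kadison-Schwarz defect of `Φ` at `X` is nonnegative. Its image under `P` is squeezed to zero
because the powers of `Φ` return `X` to itself in the limit. -/
theorem apply_star_mul_self_of_fixed {X : H →L[ℂ] H} (hX : P X = X) :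
    P (Φ (star X * X)) = P (star (Φ X) * Φ X) := by
  have hD : 0 ≤ Φ (star X * X) - star (Φ X) * Φ X := sub_nonneg.mpr (kadison_schwarz Φ hΦ X)
  -- For each `n = m + 1`, Kadison-Schwarz for `ψ = Φ ^ m` at `Φ X` bounds `Φ ^ n` of the defect by
  -- `Φ (Φ ^ n (X⋆ X) - (Φ ^ n X)⋆ (Φ ^ n X))`; then `n` runs along `F`.
  have hle : P (Φ (star X * X) - star (Φ X) * Φ X) ≤ Φ (P (star X * X) - star X * X) := by
    have hcont := continuous_of_unital Φ hΦ
    have hX' := hlim X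
    rw [hX] at hX'
    refine le_of_tendsto_of_tendsto (hlim _)
      ((hcont.tendsto _).comp ((hlim (star X * X)).sub (hX'.star.mul hX'))) ?_
    filter_upwards [hF (eventually_ge_atTop 1)] with n hn
    obtain ⟨m, rfl⟩ := Nat.exists_eq_add_of_le' hn
    obtain ⟨ψ, hψ⟩ := exists_pow_completelyPositive Φ m
    have hψ1 : ψ 1 = 1 := by
      change ψ.toLinearMap 1 = 1
      rw [hψ]
      exact Module.End.pow_apply Φ.toLinearMap m 1 ▸ Function.iterate_fixed hΦ m
    have e : ∀ Y, (Φ.toLinearMap ^ (m + 1)) Y = Φ (ψ Y) := by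
      intro Y; rw [pow_succ', ← hψ]; rfl
    have e' : ∀ Y, Φ (ψ Y) = ψ (Φ Y) := by
      intro Y; rw [← e, pow_succ, ← hψ]; rfl
    simp only [Function.comp_apply, e]
    refine OrderHomClass.mono Φ ?_
    rw [map_sub, ← e' (star X * X), e' X]
    exact sub_le_sub_left (kadison_schwarz ψ hψ1 (Φ X)) _
  have h0 : P (Φ (star X * X) - star (Φ X) * Φ X) ≤ 0 := by
    have := OrderHomClass.mono P hle
    rwa [hP, apply_apply_comm Φ P hlim hΦ, map_sub P (P _), hP, sub_self, map_zero] at this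
  have h1 := le_antisymm h0 (map_nonneg P hD)
  rwa [map_sub, sub_eq_zero] at h1

theorem apply_star_mul_of_fixed {X Y : H →L[ℂ] H} (hX : P X = X) (hY : P Y = Y) :
    P (Φ (star X * Y)) = P (star (Φ X) * Φ Y) := by
  rw [← sub_eq_zero]
  refine eq_zero_of_forall_nonneg_add (E := 0) fun t => ?_
  have hfix : P (Y + t • X) = Y + t • X := by rw [map_add, map_smul, hX, hY]
  have h := apply_star_mul_self_of_fixed Φ P hF hlim hΦ hP hfix
  have hx := apply_star_mul_self_of_fixed Φ P hF hlim hΦ hP hX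
  have hy := apply_star_mul_self_of_fixed Φ P hF hlim hΦ hP hY
  have hs : star (P (Φ (star X * Y)) - P (star (Φ X) * Φ Y)) =
      P (Φ (star Y * X)) - P (star (Φ Y) * Φ X) := by
    rw [star_sub, ← map_star, ← map_star, ← map_star]
    simp
  rw [hs]
  refine le_of_eq ?_
  simp only [map_add, map_smul, star_add, star_smul, add_mul, mul_add, smul_mul_assoc,
    mul_smul_comm, smul_add, hx, hy] at h
  rw [starRingEnd_apply, smul_sub, smul_sub]
  rw [← sub_eq_zero] at h
  rw [zero_add, ← h]
  abel

theorem apply_mul_of_fixed {X Y : H →L[ℂ] H} (hX : P X = X) (hY : P Y = Y) :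
    P (Φ (X * Y)) = P (Φ X * Φ Y) := by
  have h : P (star X) = star X := by rw [map_star, hX]
  simpa [map_star] using apply_star_mul_of_fixed Φ P hF hlim hΦ hP h hY

end Dynamics

/-! ### Minimal projections and matrix units of a star algebra. -/

section MinimalProjections

variable {K : Type*} [NormedAddCommGroup K] [InnerProductSpace ℂ K] [FiniteDimensional ℂ K]
  [CompleteSpace K] (𝔄 : StarSubalgebra ℂ (K →L[ℂ] K))

/-- A minimal projection of a star algebra of operators: a non-zero projection `p` with
`p 𝔄 p = ℂ p`. -/
structure IsMinimalProjection (p : K →L[ℂ] K) : Prop where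
  mem : p ∈ 𝔄
  isStarProjection : IsStarProjection p
  ne_zero : p ≠ 0
  exists_smul : ∀ a ∈ 𝔄, ∃ c : ℂ, p * a * p = c • p

variable {𝔄}

theorem isClosed_starSubalgebra : IsClosed (𝔄 : Set (K →L[ℂ] K)) :=
  Submodule.closed_of_finiteDimensional 𝔄.toSubalgebra.toSubmodule

/-- The spectral projections of a self-adjoint element of `𝔄` belong to `𝔄`. -/
theorem exists_spectral_projection {b : K →L[ℂ] K} (hb : b ∈ 𝔄) (hsa : IsSelfAdjoint b) {μ : ℂ}
    (hμ : μ ∈ spectrum ℂ b) : ∃ q ∈ 𝔄, IsStarProjection q ∧ q ≠ 0 ∧ b * q = μ • q := by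
  have hfin : (spectrum ℂ b).Finite := by
    have h : spectrum ℂ (b : Module.End ℂ K) = spectrum ℂ b :=
      AlgEquiv.spectrum_eq (Module.End.toContinuousLinearMap (𝕜 := ℂ) K).symm b
    rw [← h]
    refine (Module.End.finite_hasEigenvalue (b : Module.End ℂ K)).subset fun μ h => ?_
    exact Module.End.hasEigenvalue_iff_mem_spectrum.mpr h
  -- On a finite spectrum every function is continuous, so the indicator of `μ` is admissible in the
  -- functional calculus.
  have hcont : ∀ f : ℂ → ℂ, ContinuousOn f (spectrum ℂ b) := fun f => hfin.continuousOn f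
  have hn : IsStarNormal b := hsa.isStarNormal
  let f : ℂ → ℂ := fun z => if z = μ then 1 else 0
  have hf : ∀ z, f z * f z = f z := fun z => by simp [f]
  have hf' : ∀ z, star (f z) = f z := fun z => by by_cases h : z = μ <;> simp [f, h]
  have hf'' : ∀ z, z * f z = μ * f z := fun z => by by_cases h : z = μ <;> simp [f, h]
  refine ⟨cfc f b, ?_, ⟨?_, ?_⟩, ?_, ?_⟩
  · have : IsClosed (𝔄 : Set (K →L[ℂ] K)) := isClosed_starSubalgebra
    exact cfc_mem (𝕜' := ℂ) f hb
  · rw [IsIdempotentElem, ← cfc_mul f f b (hcont _) (hcont _)]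
    simp only [hf]
  · rw [IsSelfAdjoint, ← cfc_star]
    simp only [hf']
  · intro h
    have h1 : f μ ∈ spectrum ℂ (cfc f b) := by
      rw [cfc_map_spectrum f b hn (hcont _)]
      exact ⟨μ, hμ, rfl⟩
    rw [h] at h1
    have : Nontrivial (K →L[ℂ] K) := by
      by_contra hne
      rw [not_nontrivial_iff_subsingleton] at hne
      simp [spectrum.of_subsingleton] at hμ
    simp [f] at h1
  · have h1 : b * cfc f b = cfc (fun z => z * f z) b := by
      rw [cfc_mul (fun z => z) f b (hcont _) (hcont _), cfc_id' ℂ b]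
    rw [h1]
    simp only [hf'']
    rw [cfc_const_mul μ f b (hcont _)]

/-- A nonzero projection of least rank below `e` works. A spectral projection at a nonzero spectral
value of a self-adjoint element of its corner lies below it, hence equals it, so the corner is
scalar. -/
theorem exists_isMinimalProjection {e : K →L[ℂ] K} (he : e ∈ 𝔄) (hp : IsStarProjection e)
    (h0 : e ≠ 0) : ∃ p, IsMinimalProjection 𝔄 p ∧ e * p = p := by
  classical
  have hex : ∃ n : ℕ, ∃ q ∈ 𝔄, IsStarProjection q ∧ q ≠ 0 ∧ e * q = q ∧
      Module.finrank ℂ q.range = n := ⟨_, e, he, hp, h0, hp.isIdempotentElem, rfl⟩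
  obtain ⟨q, hq, hqp, hq0, heq, hrank⟩ := Nat.find_spec hex
  have hmin : ∀ r ∈ 𝔄, IsStarProjection r → r ≠ 0 → q * r = r → r = q := by
    intro r hr hrp hr0 hqr
    have hrange : r.range ≤ q.range := by
      rintro _ ⟨x, rfl⟩
      exact ⟨r x, congrArg (fun f : K →L[ℂ] K => f x) hqr⟩
    have hle : Module.finrank ℂ q.range ≤ Module.finrank ℂ r.range := by
      rw [hrank]
      exact Nat.find_min' hex ⟨r, hr, hrp, hr0, by rw [← hqr, ← mul_assoc, heq], rfl⟩
    have hrange' := Submodule.eq_of_le_of_finrank_le hrange hle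
    have h1 : r * q = q := by
      ext x
      have hx : q x ∈ r.range := hrange' ▸ ⟨x, rfl⟩
      obtain ⟨y, hy⟩ := hx
      have hy' : r y = q x := hy
      rw [mul_apply_eq_comp, ← hy', ← mul_apply_eq_comp, hrp.isIdempotentElem.eq]
    have h2 := congrArg star hqr
    rw [star_mul, hqp.isSelfAdjoint.star_eq, hrp.isSelfAdjoint.star_eq, h1] at h2
    exact h2.symm
  have hsa : ∀ b ∈ 𝔄, IsSelfAdjoint b → q * b = b → ∃ c : ℂ, b = c • q := by
    intro b hb hbs hqb
    by_cases hspec : ∃ μ ∈ spectrum ℂ b, μ ≠ 0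
    · obtain ⟨μ, hμ, hμ0⟩ := hspec
      obtain ⟨r, hr, hrp, hr0, hbr⟩ := exists_spectral_projection hb hbs hμ
      have hqr : q * r = r := by
        have : r = μ⁻¹ • (b * r) := by rw [hbr, smul_smul, inv_mul_cancel₀ hμ0, one_smul]
        rw [this, mul_smul_comm, ← mul_assoc, hqb]
      rw [hmin r hr hrp hr0 hqr] at hbr
      have h2 := congrArg star hqb
      rw [star_mul, hqp.isSelfAdjoint.star_eq, hbs.star_eq] at h2
      exact ⟨μ, by rw [← hbr, h2]⟩
    · refine ⟨0, ?_⟩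
      rw [zero_smul]
      refine CFC.eq_zero_of_spectrum_subset_zero (R := ℂ) b (fun μ hμ => ?_) hbs.isStarNormal
      by_contra h
      exact hspec ⟨μ, hμ, h⟩
  refine ⟨q, ⟨hq, hqp, hq0, fun a ha => ?_⟩, heq⟩
  have key : ∀ b ∈ 𝔄, IsSelfAdjoint b → ∃ c : ℂ, q * b * q = c • q := by
    intro b hb hbs
    refine hsa _ (mul_mem (mul_mem hq hb) hq) ?_ ?_
    · have := hbs.conjugate q
      rwa [hqp.isSelfAdjoint.star_eq] at this
    · rw [← mul_assoc, ← mul_assoc, hqp.isIdempotentElem.eq]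
  obtain ⟨c₁, h₁⟩ := key (a + star a) (add_mem ha (star_mem ha)) (IsSelfAdjoint.add_star_self a)
  obtain ⟨c₂, h₂⟩ := key (Complex.I • (a - star a))
    (SMulMemClass.smul_mem _ (sub_mem ha (star_mem ha)))
    (by simp [IsSelfAdjoint, star_sub, smul_sub, neg_add_eq_sub])
  refine ⟨(1 / 2) * (c₁ - Complex.I * c₂), ?_⟩
  have : a = (1 / 2 : ℂ) • ((a + star a) - Complex.I • (Complex.I • (a - star a))) := by
    rw [smul_smul, Complex.I_mul_I]
    module
  rw [this, mul_smul_comm, smul_mul_assoc, mul_sub, sub_mul, h₁, mul_smul_comm, smul_mul_assoc, h₂]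
  module

/-- Matrix units of `𝔄` in the column of a minimal projection `p`. -/
theorem IsMinimalProjection.exists_column {p : K →L[ℂ] K} (hp : IsMinimalProjection 𝔄 p) :
    ∃ (d : ℕ) (a : Fin d → K →L[ℂ] K), (∀ i, a i ∈ 𝔄) ∧ (∀ i, a i * p = a i) ∧
      (∀ i j, star (a i) * a j = if i = j then p else 0) ∧
      ∀ b ∈ 𝔄, b * p = b → ∃ c : Fin d → ℂ, b = ∑ i, c i • a i := by
  have hps := hp.isStarProjection.isSelfAdjoint.star_eq
  have hpp := hp.isStarProjection.isIdempotentElem.eq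
  obtain ⟨ξ, hξ, hpξ⟩ : ∃ ξ : K, ‖ξ‖ = 1 ∧ p ξ = ξ := by
    obtain ⟨x, hx⟩ : ∃ x, p x ≠ 0 := by
      by_contra! h
      exact hp.ne_zero (ContinuousLinearMap.ext h)
    refine ⟨((‖p x‖⁻¹ : ℝ) : ℂ) • p x, ?_, ?_⟩
    · have := norm_ne_zero_iff.mpr hx
      rw [norm_smul]; simp [this]
    · rw [map_smul, ← mul_apply_eq_comp, hpp]
  let L : Submodule ℂ K := 𝔄.toSubalgebra.toSubmodule.map
    ((ContinuousLinearMap.apply ℂ K ξ).toLinearMap)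
  let v := stdOrthonormalBasis ℂ L
  have hv : ∀ i, ∃ a ∈ 𝔄, a ξ = v i := fun i => (v i).2
  choose a₀ ha₀ hav using hv
  -- Minimality makes the evaluation `b ↦ b ξ` an isometry of the column `𝔄 p` for the form given by
  -- `b⋆ c`; an orthonormal basis of its image then lifts to matrix units.
  have hsmul : ∀ b ∈ 𝔄, ∀ c ∈ 𝔄, b * p = b → c * p = c →
      star b * c = (inner ℂ (b ξ) (c ξ) : ℂ) • p := by
    intro b hb c hc hbp hcp
    obtain ⟨z, hz⟩ := hp.exists_smul (star b * c) (mul_mem (star_mem hb) hc)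
    have h1 : star b * c = z • p := by
      rw [← hz, mul_assoc, mul_assoc, hcp, ← mul_assoc]
      conv_lhs => rw [← hbp, star_mul, hps]
    have h2 : inner ℂ (b ξ) (c ξ) = z := by
      rw [← ContinuousLinearMap.adjoint_inner_right, ← ContinuousLinearMap.star_eq_adjoint,
        ← mul_apply_eq_comp, h1, smul_apply, hpξ, inner_smul_right, inner_self_eq_norm_sq_to_K, hξ]
      simp
    rw [h1, h2]
  have hap : ∀ i, a₀ i * p * p = a₀ i * p := fun i => by rw [mul_assoc, hpp]
  have hmem : ∀ i, a₀ i * p ∈ 𝔄 := fun i => mul_mem (ha₀ i) hp.mem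
  have hval : ∀ i, (a₀ i * p) ξ = v i := fun i => by rw [mul_apply_eq_comp, hpξ, hav]
  refine ⟨_, fun i => a₀ i * p, hmem, hap, fun i j => ?_, fun b hb hbp => ?_⟩
  · rw [hsmul _ (hmem i) _ (hmem j) (hap i) (hap j), hval, hval, ← Submodule.coe_inner,
      orthonormal_iff_ite.mp v.orthonormal]
    split_ifs <;> simp
  · have hbL : b ξ ∈ L := ⟨b, hb, rfl⟩
    refine ⟨fun i => inner ℂ (v i) ⟨b ξ, hbL⟩, ?_⟩
    rw [← sub_eq_zero]
    set D := b - ∑ i, (inner ℂ (v i) ⟨b ξ, hbL⟩ : ℂ) • (a₀ i * p) with hD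
    have hDmem : D ∈ 𝔄 := sub_mem hb (sum_mem fun i _ => SMulMemClass.smul_mem _ (hmem i))
    have hDp : D * p = D := by
      rw [hD, sub_mul, hbp, Finset.sum_mul]
      simp only [smul_mul_assoc, hap]
    have hDξ : D ξ = 0 := by
      have := congrArg Subtype.val (v.sum_repr' ⟨b ξ, hbL⟩)
      rw [hD, sub_apply, sum_apply, sub_eq_zero]
      refine this.symm.trans ?_
      simp only [smul_apply, hval, AddSubmonoidClass.coe_finsetSum, Submodule.coe_smul]
    have := hsmul D hDmem D hDmem hDp hDp
    rw [hDξ, inner_zero_left, zero_smul] at this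
    exact (CStarRing.star_mul_self_eq_zero_iff D).mp this

end MinimalProjections

section Family

variable {K : Type*} [NormedAddCommGroup K] [InnerProductSpace ℂ K] [FiniteDimensional ℂ K]
  [CompleteSpace K] (𝔄 : StarSubalgebra ℂ (K →L[ℂ] K))

/-- A finite set of pairwise inequivalent minimal projections. -/
def IsMinimalFamily (S : Finset (K →L[ℂ] K)) : Prop :=
  (∀ p ∈ S, IsMinimalProjection 𝔄 p) ∧
    ∀ p ∈ S, ∀ q ∈ S, p ≠ q → ∀ b ∈ 𝔄, p * b * q = 0

variable {𝔄}

/-- Inequivalence at `b = 1` makes the ranges mutually orthogonal. The bound is what allows a family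
of maximal cardinality to be chosen. -/
theorem IsMinimalFamily.card_le {S : Finset (K →L[ℂ] K)} (hS : IsMinimalFamily 𝔄 S) :
    S.card ≤ Module.finrank ℂ K := by
  have h : ∀ p : S, ∃ x, p.1 x ≠ 0 := by
    intro p
    by_contra! h
    exact (hS.1 p p.2).ne_zero (ContinuousLinearMap.ext h)
  choose x hx using h
  have hli : LinearIndependent ℂ fun p : S => p.1 (x p) := by
    refine linearIndependent_of_ne_zero_of_inner_eq_zero hx fun p q hpq => ?_
    have h1 := hS.2 p p.2 q q.2 (fun h => hpq (Subtype.ext h)) 1 (one_mem _)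
    rw [mul_one] at h1
    have h2 := (hS.1 p p.2).isStarProjection.isSelfAdjoint.star_eq
    change inner ℂ (p.1 (x p)) (q.1 (x q)) = 0
    rw [← h2, ContinuousLinearMap.star_eq_adjoint, ContinuousLinearMap.adjoint_inner_left,
      ← mul_apply_eq_comp, h1]
    simp
  simpa using hli.fintype_card_le_finrank

theorem exists_maximal_isMinimalFamily (𝔄 : StarSubalgebra ℂ (K →L[ℂ] K)) :
    ∃ S, IsMinimalFamily 𝔄 S ∧ ∀ T, IsMinimalFamily 𝔄 T → T.card ≤ S.card := by
  let N : Set ℕ := {n | ∃ S, IsMinimalFamily 𝔄 S ∧ S.card = n}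
  have hne : N.Nonempty := ⟨0, ∅, ⟨by simp, by simp⟩, rfl⟩
  have hbdd : BddAbove N := ⟨Module.finrank ℂ K, by rintro _ ⟨S, hS, rfl⟩; exact hS.card_le⟩
  obtain ⟨S, hS, hcard⟩ := Nat.sSup_mem hne hbdd
  exact ⟨S, hS, fun T hT => hcard ▸ le_csSup hbdd ⟨T, hT, rfl⟩⟩

variable (𝔄) in
/-- A system of matrix units: minimal projections `p k` of `𝔄`, one from each equivalence class, and
the first columns `a k i` of matrix units of the blocks, with `p k` as the corner. -/
theorem exists_matrixUnits :
    ∃ (M : ℕ) (p : Fin M → K →L[ℂ] K) (d : Fin M → ℕ) (a : ∀ k, Fin (d k) → K →L[ℂ] K),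
      (∀ k, IsMinimalProjection 𝔄 (p k)) ∧ (∀ k i, a k i ∈ 𝔄) ∧ (∀ k i, a k i * p k = a k i) ∧
      (∀ k i j, star (a k i) * a k j = if i = j then p k else 0) ∧
      (∀ k l, k ≠ l → ∀ i j, star (a k i) * a l j = 0) ∧
      (∀ k, ∀ b ∈ 𝔄, b * p k = b → ∃ c : Fin (d k) → ℂ, b = ∑ i, c i • a k i) ∧
      ∑ k, ∑ i, a k i * star (a k i) = 1 := by
  classical
  obtain ⟨S, hS, hmax⟩ := exists_maximal_isMinimalFamily 𝔄
  let p : Fin S.card → K →L[ℂ] K := fun k => (S.equivFin.symm k).1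
  have hpS : ∀ k, p k ∈ S := fun k => (S.equivFin.symm k).2
  have hp : ∀ k, IsMinimalProjection 𝔄 (p k) := fun k => hS.1 _ (hpS k)
  have hpinj : ∀ k l, k ≠ l → p k ≠ p l := fun k l hkl h =>
    hkl (S.equivFin.symm.injective (Subtype.ext h))
  have hps : ∀ k, star (p k) = p k := fun k => (hp k).isStarProjection.isSelfAdjoint.star_eq
  choose d a ha hap horth hspan using fun k => (hp k).exists_column
  have hpa : ∀ k i, p k * star (a k i) = star (a k i) := fun k i => by
    rw [← hps k, ← star_mul, hap]
  have hcross : ∀ k l, k ≠ l → ∀ i j, star (a k i) * a l j = 0 := by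
    intro k l hkl i j
    rw [← hpa k i, ← hap l j, ← mul_assoc, mul_assoc (p k)]
    exact hS.2 _ (hpS k) _ (hpS l) (hpinj k l hkl) _ (mul_mem (star_mem (ha k i)) (ha l j))
  refine ⟨S.card, p, d, a, hp, ha, hap, horth, hcross, hspan, ?_⟩
  set z := ∑ k, ∑ i, a k i * star (a k i) with hz
  have hza : ∀ l j, z * a l j = a l j := by
    intro l j
    rw [hz, Finset.sum_mul, Finset.sum_eq_single l, Finset.sum_mul, Finset.sum_eq_single j,
      mul_assoc, horth, if_pos rfl, hap]
    · intro i _ hij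
      rw [mul_assoc, horth, if_neg hij, mul_zero]
    · simp
    · intro k _ hkl
      rw [Finset.sum_mul]
      exact Finset.sum_eq_zero fun i _ => by rw [mul_assoc, hcross k l hkl, mul_zero]
    · simp
  have hzmem : z ∈ 𝔄 :=
    sum_mem fun k _ => sum_mem fun i _ => mul_mem (ha k i) (star_mem (ha k i))
  have hzproj : IsStarProjection z := by
    constructor
    · have h : z * ∑ k, ∑ i, a k i * star (a k i) = z := by
        simp only [Finset.mul_sum, ← mul_assoc, hza]
        exact hz.symm
      rwa [← hz] at h
    · rw [IsSelfAdjoint, hz]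
      simp [star_sum]
  by_contra hne
  -- A minimal projection `q` below `1 - z` annihilates every column, so it is inequivalent to all
  -- members of `S` and contradicts maximality.
  have he0 : 1 - z ≠ 0 := fun h => hne (sub_eq_zero.mp h).symm
  obtain ⟨q, hq, heq⟩ := exists_isMinimalProjection (sub_mem (one_mem 𝔄) hzmem)
    hzproj.one_sub he0
  have hqs := hq.isStarProjection.isSelfAdjoint.star_eq
  have hqe : q * (1 - z) = q := by
    have := congrArg star heq
    rwa [star_mul, hqs, hzproj.one_sub.isSelfAdjoint.star_eq] at this
  have hqa : ∀ k i, q * a k i = 0 := by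
    intro k i
    rw [← hqe, mul_assoc, sub_mul, one_mul, hza, sub_self, mul_zero]
  have hqp : ∀ k, ∀ b ∈ 𝔄, q * b * p k = 0 := by
    intro k b hb
    obtain ⟨c, hc⟩ := hspan k (b * p k) (mul_mem hb (hp k).mem)
      (by rw [mul_assoc, (hp k).isStarProjection.isIdempotentElem.eq])
    rw [mul_assoc, hc, Finset.mul_sum]
    exact Finset.sum_eq_zero fun i _ => by rw [mul_smul_comm, hqa, smul_zero]
  have hqS : ∀ r ∈ S, ∀ b ∈ 𝔄, q * b * r = 0 := by
    intro r hr b hb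
    have := hqp (S.equivFin ⟨r, hr⟩) b hb
    simpa [p] using this
  have hqS' : ∀ r ∈ S, ∀ b ∈ 𝔄, r * b * q = 0 := by
    intro r hr b hb
    have := congrArg star (hqS r hr (star b) (star_mem hb))
    rwa [star_mul, star_mul, star_star, hqs, (hS.1 r hr).isStarProjection.isSelfAdjoint.star_eq,
      star_zero, ← mul_assoc] at this
  have hqn : q ∉ S := by
    intro h
    have := hqS q h 1 (one_mem _)
    rw [mul_one, hq.isStarProjection.isIdempotentElem.eq] at this
    exact hq.ne_zero this
  have hT : IsMinimalFamily 𝔄 (insert q S) := by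
    refine ⟨fun r hr => ?_, fun r hr s hs hrs b hb => ?_⟩
    · rcases Finset.mem_insert.mp hr with rfl | hr
      · exact hq
      · exact hS.1 r hr
    · rcases Finset.mem_insert.mp hr with hr' | hr' <;>
        rcases Finset.mem_insert.mp hs with hs' | hs'
      · exact absurd (hr'.trans hs'.symm) hrs
      · rw [hr']; exact hqS s hs' b hb
      · rw [hs']; exact hqS' r hr' b hb
      · exact hS.2 r hr' s hs' hrs b hb
  have := hmax _ hT
  rw [Finset.card_insert_of_notMem hqn] at this
  omega

end Family

/-! ### Block form of star algebras of operators. -/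

section Blocks

variable {M : ℕ} (d m : Fin M → ℕ)

/-- The standard orthonormal basis of `⨁ₖ ℂ^{dₖ} ⊗ ℂ^{mₖ}`. -/
noncomputable def blockBasis :
    OrthonormalBasis (Σ k, Fin (d k) × Fin (m k)) ℂ (BlockSpace d m) :=
  Pi.orthonormalBasis fun k =>
    (EuclideanSpace.basisFun (Fin (d k)) ℂ).tensorProduct (EuclideanSpace.basisFun (Fin (m k)) ℂ)

variable {d}

theorem blockOp_blockBasis (x : BlockFamily d) (k : Fin M) (i : Fin (d k)) (j : Fin (m k)) :
    blockOp m x (blockBasis d m ⟨k, i, j⟩) =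
      ∑ i', (x k (EuclideanSpace.single i 1)) i' • blockBasis d m ⟨k, i', j⟩ := by
  have h : x k (EuclideanSpace.single i 1) =
      ∑ i', (x k (EuclideanSpace.single i 1)) i' • EuclideanSpace.single i' (1 : ℂ) := by
    conv_lhs => rw [← (EuclideanSpace.basisFun (Fin (d k)) ℂ).sum_repr (x k _)]
    simp
  ext l
  rw [blockOp_apply]
  simp only [blockBasis, Pi.orthonormalBasis_apply, OrthonormalBasis.tensorProduct_apply,
    EuclideanSpace.basisFun_apply]
  by_cases hl : l = k
  · subst hl
    have hs : ∀ v : EuclideanSpace ℂ (Fin (d l)) ⊗[ℂ] EuclideanSpace ℂ (Fin (m l)),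
        (PiLp.single 2 l v : BlockSpace d m) l = v := fun v => by simp
    have hsum : (∑ i', (x l (EuclideanSpace.single i 1)) i' • (PiLp.single 2 l
        (EuclideanSpace.single i' (1 : ℂ) ⊗ₜ[ℂ] EuclideanSpace.single j (1 : ℂ)) :
          BlockSpace d m)) l = ∑ i', (x l (EuclideanSpace.single i 1)) i' •
        (EuclideanSpace.single i' (1 : ℂ) ⊗ₜ[ℂ] EuclideanSpace.single j (1 : ℂ)) := by
      simp
    rw [hs, hsum, TensorProduct.mapL_tmul]
    conv_lhs => rw [h]
    rw [TensorProduct.sum_tmul]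
    simp [TensorProduct.smul_tmul']
  · simp [hl]

variable {m} {K : Type*} [NormedAddCommGroup K] [InnerProductSpace ℂ K] [CompleteSpace K]

theorem blockHom_injective (hm : ∀ k, 0 < m k) : Function.Injective (blockHom (d := d) m) := by
  rw [injective_iff_map_eq_zero]
  intro x hx
  funext k
  rw [← ContinuousLinearMap.coe_inj]
  refine (EuclideanSpace.basisFun (Fin (d k)) ℂ).toBasis.ext fun i => ?_
  have h1 : blockOp m x (blockBasis d m ⟨k, i, ⟨0, hm k⟩⟩) = 0 :=
    congrArg (fun f : BlockSpace d m →L[ℂ] BlockSpace d m => f _) hx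
  rw [blockOp_blockBasis] at h1
  ext i'
  have hli := (blockBasis d m).toBasis.linearIndependent.comp
    (fun i' : Fin (d k) => (⟨k, i', ⟨0, hm k⟩⟩ : Σ k, Fin (d k) × Fin (m k)))
    (fun a b h => by simpa using h)
  have := Fintype.linearIndependent_iff.mp hli _ (by simpa using h1) i'
  simpa using this

theorem blockEmbed_injective (hm : ∀ k, 0 < m k) (W : BlockSpace d m ≃ₗᵢ[ℂ] K) :
    Function.Injective (blockEmbed W) :=
  W.conjStarAlgEquiv.injective.comp (blockHom_injective hm)

end Blocks

section Structure

variable {K : Type*} [NormedAddCommGroup K] [InnerProductSpace ℂ K] [FiniteDimensional ℂ K]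
  [CompleteSpace K]

/-- Every star algebra of operators on a finite-dimensional Hilbert space is unitarily equivalent to
`⨁ₖ B(ℂ^{dₖ}) ⊗ ℂI`. -/
theorem exists_blockAlgebra_eq (𝔄 : StarSubalgebra ℂ (K →L[ℂ] K)) :
    ∃ (M : ℕ) (d m : Fin M → ℕ) (_ : ∀ k, 0 < d k ∧ 0 < m k) (W : BlockSpace d m ≃ₗᵢ[ℂ] K),
      blockAlgebra W = 𝔄 := by
  classical
  obtain ⟨M, p, d, a, hp, ha, hap, horth, hcross, hspan, hone⟩ := exists_matrixUnits 𝔄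
  have hps : ∀ k, star (p k) = p k := fun k => (hp k).isStarProjection.isSelfAdjoint.star_eq
  have hpp : ∀ k, p k * p k = p k := fun k => (hp k).isStarProjection.isIdempotentElem.eq
  let m : Fin M → ℕ := fun k => Module.finrank ℂ (p k).range
  let ξ : ∀ k, OrthonormalBasis (Fin (m k)) ℂ (p k).range :=
    fun k => stdOrthonormalBasis ℂ (p k).range
  have hpξ : ∀ k j, p k (ξ k j) = ξ k j := by
    intro k j
    obtain ⟨y, hy⟩ := (ξ k j).2
    have hy' : p k y = ξ k j := hy
    rw [← hy', ← mul_apply_eq_comp, hpp]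
  -- In these vectors `a k i' * star (a k i)` is a matrix unit on the first tensor factor and the
  -- identity on the second.
  let u : (Σ k, Fin (d k) × Fin (m k)) → K := fun s => a s.1 s.2.1 (ξ s.1 s.2.2)
  have hau : ∀ k l i i' j, star (a k i) (u ⟨l, i', j⟩) =
      if h : k = l then (if h ▸ i = i' then (ξ l j : K) else 0) else 0 := by
    intro k l i i' j
    change star (a k i) (a l i' (ξ l j)) = _
    rw [← mul_apply_eq_comp]
    by_cases h : k = l
    · subst h
      by_cases hi : i = i'
      · simp [horth, hi, hpξ]
      · simp [horth, hi]
    · simp [h, hcross k l h]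
  have hon : Orthonormal ℂ u := by
    rw [orthonormal_iff_ite]
    rintro ⟨k, i, j⟩ ⟨l, i', j'⟩
    change inner ℂ (a k i (ξ k j)) (u ⟨l, i', j'⟩) = _
    rw [← ContinuousLinearMap.adjoint_inner_right, ← ContinuousLinearMap.star_eq_adjoint, hau]
    by_cases h : k = l
    · subst h
      by_cases hi : i = i'
      · subst hi
        simp [← Submodule.coe_inner, orthonormal_iff_ite.mp (ξ k).orthonormal]
      · simp [hi]
    · simp [h]
  have hsp : ⊤ ≤ Submodule.span ℂ (Set.range u) := by
    intro v _
    have hv : v = ∑ k, ∑ i, a k i (star (a k i) v) := by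
      have := congrArg (fun f : K →L[ℂ] K => f v) hone
      simpa [sum_apply] using this.symm
    rw [hv]
    refine sum_mem fun k _ => sum_mem fun i _ => ?_
    have hmem : star (a k i) v ∈ (p k).range := by
      refine ⟨star (a k i) v, ?_⟩
      change p k (star (a k i) v) = _
      rw [← mul_apply_eq_comp, ← hps k, ← star_mul, hap]
    have := congrArg Subtype.val ((ξ k).sum_repr ⟨_, hmem⟩)
    simp only [AddSubmonoidClass.coe_finsetSum, Submodule.coe_smul] at this
    rw [← this, map_sum]
    refine sum_mem fun j _ => ?_
    rw [map_smul]
    exact Submodule.smul_mem _ _ (Submodule.subset_span ⟨⟨k, i, j⟩, rfl⟩)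
  let B := OrthonormalBasis.mk hon hsp
  have hB : ∀ s, B s = u s := fun s => by simp [B]
  let W : BlockSpace d m ≃ₗᵢ[ℂ] K := (blockBasis d m).equiv B (Equiv.refl _)
  have hW : ∀ s, W (blockBasis d m s) = u s := fun s => by simp [W, hB]
  have hembed : ∀ (x : BlockFamily d) k i j, blockEmbed W x (u ⟨k, i, j⟩) =
      ∑ i', (x k (EuclideanSpace.single i 1)) i' • u ⟨k, i', j⟩ := by
    intro x k i j
    change W (blockOp m x (W.symm (u ⟨k, i, j⟩))) = _
    rw [← hW, W.symm_apply_apply, blockOp_blockBasis, map_sum]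
    simp only [map_smul, hW]
  have hext : ∀ S T : K →L[ℂ] K, (∀ k i j, S (u ⟨k, i, j⟩) = T (u ⟨k, i, j⟩)) → S = T := by
    intro S T h
    rw [← ContinuousLinearMap.coe_inj]
    refine B.toBasis.ext fun ⟨k, i, j⟩ => ?_
    simpa [hB] using h k i j
  refine ⟨M, d, m, fun k => ⟨?_, ?_⟩, W, ?_⟩
  · rcases Nat.eq_zero_or_pos (d k) with h | h
    · obtain ⟨c, hc⟩ := hspan k (p k) (hp k).mem (hpp k)
      have : IsEmpty (Fin (d k)) := by rw [h]; infer_instance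
      simp at hc
      exact absurd hc (hp k).ne_zero
    · exact h
  · have : Nontrivial (p k).range := by
      rw [Submodule.nontrivial_iff_ne_bot]
      intro h
      refine (hp k).ne_zero ?_
      rw [← ContinuousLinearMap.coe_inj]
      exact LinearMap.range_eq_bot.mp h
    exact Module.finrank_pos
  · refine le_antisymm ?_ ?_
    · rintro _ ⟨x, rfl⟩
      have : blockEmbed W x = ∑ k, ∑ i, ∑ i', (x k (EuclideanSpace.single i 1)) i' •
          (a k i' * star (a k i)) := by
        refine hext _ _ fun l i j => ?_
        rw [hembed]
        symm
        rw [sum_apply, Finset.sum_eq_single l]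
        · rw [sum_apply, Finset.sum_eq_single i]
          · simp only [sum_apply, smul_apply, mul_apply_eq_comp, hau]
            simp [u]
          · intro i₂ _ hi₂
            simp only [sum_apply, smul_apply, mul_apply_eq_comp, hau]
            simp [hi₂]
          · simp
        · intro k _ hk
          simp only [sum_apply, smul_apply, mul_apply_eq_comp, hau]
          simp [hk]
        · simp
      change blockEmbed W x ∈ 𝔄
      rw [this]
      exact sum_mem fun k _ => sum_mem fun i _ => sum_mem fun i' _ =>
        SMulMemClass.smul_mem _ (mul_mem (ha k i') (star_mem (ha k i)))
    · intro b hb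
      have hc : ∀ k i, ∃ c : Fin (d k) → ℂ, b * a k i = ∑ i', c i' • a k i' := fun k i =>
        hspan k _ (mul_mem hb (ha k i)) (by rw [mul_assoc, hap])
      choose c hc using hc
      let x : BlockFamily d := fun k => ((EuclideanSpace.basisFun (Fin (d k)) ℂ).toBasis.constr ℂ
        fun i => WithLp.toLp 2 (c k i)).toContinuousLinearMap
      have hx : ∀ k i, x k (EuclideanSpace.single i 1) = WithLp.toLp 2 (c k i) := by
        intro k i
        have := (EuclideanSpace.basisFun (Fin (d k)) ℂ).toBasis.constr_basis ℂ
          (fun i => WithLp.toLp 2 (c k i)) i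
        rwa [OrthonormalBasis.coe_toBasis, EuclideanSpace.basisFun_apply] at this
      refine ⟨x, ?_⟩
      change blockEmbed W x = b
      refine hext _ _ fun k i j => ?_
      rw [hembed, hx]
      have := congrArg (fun f : K →L[ℂ] K => f (ξ k j)) (hc k i)
      simp only [mul_apply_eq_comp, sum_apply, smul_apply] at this
      exact this.symm

end Structure

/-! ### Star automorphisms of a direct sum of matrix algebras. -/

section Automorphism

variable {M : ℕ} {d : Fin M → ℕ}

theorem eq_zero_or_eq_one_of_central {V : Type*} [NormedAddCommGroup V] [InnerProductSpace ℂ V]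
    [FiniteDimensional ℂ V] {f : V →L[ℂ] V} (hf : f * f = f) (hc : ∀ y, y * f = f * y) :
    f = 0 ∨ f = 1 := by
  obtain ⟨c, hc⟩ := by simpa using (Subalgebra.mem_center_iff (R := ℂ)).mpr hc
  rcases subsingleton_or_nontrivial V with hV | hV
  · left
    ext v
    exact Subsingleton.elim _ _
  · have hc' : c • (1 : V →L[ℂ] V) = f := by
      rw [← hc]; exact (Algebra.algebraMap_eq_smul_one c).symm
    rw [← hc', smul_mul_smul_comm, mul_one] at hf
    have h2 : c * c = c := smul_left_injective ℂ one_ne_zero hf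
    rcases IsIdempotentElem.iff_eq_zero_or_one.mp h2 with h | h
    · left; rw [← hc', h, zero_smul]
    · right; rw [← hc', h, one_smul]

/-- Every automorphism of the star algebra `⨁ₖ B(ℂ^{dₖ})` permutes the blocks and acts by unitary
conjugation between them. -/
theorem exists_eq_permConj (hd : ∀ k, 0 < d k) (α : BlockFamily d →⋆ₐ[ℂ] BlockFamily d)
    (hα : Function.Injective α) :
    ∃ (π : Equiv.Perm (Fin M)) (hπ : ∀ k, d k = d (π k))
      (U : ∀ k, unitary (EuclideanSpace ℂ (Fin (d k)) →L[ℂ] EuclideanSpace ℂ (Fin (d k)))),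
      ∀ x, α x = permConj π hπ U x := by
  classical
  have hsurj : Function.Surjective α :=
    LinearMap.injective_iff_surjective (f := α.toAlgHom.toLinearMap).mp hα
  let e : Fin M → BlockFamily d := fun k => Pi.single k 1
  have hne : ∀ k, (1 : EuclideanSpace ℂ (Fin (d k)) →L[ℂ] EuclideanSpace ℂ (Fin (d k))) ≠ 0 := by
    intro k
    have : Nonempty (Fin (d k)) := ⟨⟨0, hd k⟩⟩
    exact one_ne_zero
  -- Block units are central idempotents and `α` is onto, so each component of their images is a
  -- central idempotent of a full operator algebra, hence 0 or 1.
  have h01 : ∀ j k, α (e k) j = 0 ∨ α (e k) j = 1 := by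
    intro j k
    refine eq_zero_or_eq_one_of_central ?_ fun y => ?_
    · rw [← Pi.mul_apply, ← map_mul]
      simp [e, ← Pi.single_mul]
    · obtain ⟨x, hx⟩ := hsurj (Pi.single j y)
      have h : α x * α (e k) = α (e k) * α x := by
        rw [← map_mul, ← map_mul]
        congr 1
        funext l
        by_cases h : l = k
        · subst h; simp [e]
        · simp [e, h]
      rw [hx] at h
      simpa using congrFun h j
  have hex : ∀ j, ∃ k, α (e k) j = 1 := by
    intro j
    by_contra! h
    have h1 : ∑ k, α (e k) j = 1 := by
      have h2 : ∑ k, e k = 1 := Finset.univ_sum_single (1 : BlockFamily d)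
      rw [← Finset.sum_apply, ← map_sum, h2, map_one, Pi.one_apply]
    rw [Finset.sum_eq_zero fun k _ => (h01 j k).resolve_right (h k)] at h1
    exact hne j h1.symm
  choose π₀ hπ₀ using hex
  have hzero : ∀ j k, k ≠ π₀ j → ∀ y, α (Pi.single k y) j = 0 := by
    intro j k hk y
    rw [← mul_one (α (Pi.single k y) j), ← hπ₀ j, ← Pi.mul_apply, ← map_mul]
    have : (Pi.single k y : BlockFamily d) * e (π₀ j) = 0 := by
      funext l
      by_cases h : l = k
      · subst h; simp [e, hk]
      · simp [h]
    rw [this, map_zero, Pi.zero_apply]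
  have hπsurj : Function.Surjective π₀ := by
    intro k
    by_contra! h
    have h1 : α (e k) = 0 := funext fun j => hzero j k (h j).symm 1
    have h2 : e k = 0 := hα (h1.trans (map_zero α).symm)
    exact hne k (by simpa [e] using congrFun h2 k)
  let π : Equiv.Perm (Fin M) := Equiv.ofBijective π₀ (Finite.surjective_iff_bijective.mp hπsurj)
  have hval : ∀ x j, α x j = α (Pi.single (π j) (x (π j))) j := by
    intro x j
    have h : (Pi.single (π j) (x (π j)) : BlockFamily d) = x * e (π₀ j) := by
      funext l
      change (Pi.single (π₀ j) (x (π₀ j)) : BlockFamily d) l = _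
      by_cases h : l = π₀ j
      · subst h; simp [e]
      · simp [e, h]
    rw [h, map_mul, Pi.mul_apply, hπ₀, mul_one]
  have hblock : ∀ j, ∃ E : EuclideanSpace ℂ (Fin (d (π j))) ≃ₗᵢ[ℂ] EuclideanSpace ℂ (Fin (d j)),
      ∀ y, α (Pi.single (π j) y) j = E.conjStarAlgEquiv y := by
    intro j
    let β : (EuclideanSpace ℂ (Fin (d (π j))) →L[ℂ] EuclideanSpace ℂ (Fin (d (π j)))) →⋆ₙₐ[ℂ]
        (EuclideanSpace ℂ (Fin (d j)) →L[ℂ] EuclideanSpace ℂ (Fin (d j))) :=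
      { toFun := fun y => α (Pi.single (π j) y) j
        map_smul' := fun c y => by
          rw [Pi.single_smul, map_smul]; rfl
        map_zero' := by rw [Pi.single_zero, map_zero, Pi.zero_apply]
        map_add' := fun y z => by rw [Pi.single_add, map_add, Pi.add_apply]
        map_mul' := fun y z => by rw [Pi.single_mul, map_mul, Pi.mul_apply]
        map_star' := fun y => by
          have h : (Pi.single (π j) (star y) : BlockFamily d) = star (Pi.single (π j) y) := by
            funext l
            by_cases hl : l = π j
            · subst hl; simp
            · simp only [Pi.star_apply, Pi.single_eq_of_ne hl]
              exact (star_zero (EuclideanSpace ℂ (Fin (d l)) →L[ℂ] EuclideanSpace ℂ (Fin (d l)))).symm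
          rw [h, map_star, Pi.star_apply] }
    have hβ : ∀ y, β y = α (Pi.single (π j) y) j := fun _ => rfl
    have hinj : Function.Injective β := by
      rw [injective_iff_map_eq_zero]
      intro y hy
      have h1 : α (Pi.single (π j) y) = 0 := by
        funext l
        by_cases h : l = j
        · subst h; exact hy
        · exact hzero l (π j) (fun h' => h (π.injective h').symm) y
      have h2 : (Pi.single (π j) y : BlockFamily d) = 0 := hα (h1.trans (map_zero α).symm)
      simpa using congrFun h2 (π j)
    have hsurj' : Function.Surjective β := by
      intro y
      obtain ⟨x, hx⟩ := hsurj (Pi.single j y)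
      exact ⟨x (π j), by rw [hβ, ← hval, hx, Pi.single_eq_same]⟩
    let f := StarAlgEquiv.ofBijective β ⟨hinj, hsurj'⟩
    have hcont : Continuous f :=
      LinearMap.continuous_of_finiteDimensional (f.toAlgEquiv.toLinearMap)
    obtain ⟨E, hE⟩ := StarAlgEquiv.eq_linearIsometryEquivConjStarAlgEquiv f hcont
    exact ⟨E, fun y => by rw [← hE]; rfl⟩
  choose E hE using hblock
  have hπ : ∀ k, d k = d (π k) := by
    intro k
    simpa using (E k).toLinearEquiv.finrank_eq.symm
  let L : ∀ j, EuclideanSpace ℂ (Fin (d (π j))) ≃ₗᵢ[ℂ] EuclideanSpace ℂ (Fin (d j)) := fun j =>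
    LinearIsometryEquiv.piLpCongrLeft 2 ℂ ℂ (finCongr (hπ j).symm)
  -- Chosen as `E⁻¹ L`, so that conjugating by it and then transporting along `L` gives conjugation
  -- by `E`. It lives on the source block `π j`, which is why the family is then reindexed along
  -- `π`.
  let U' : ∀ j, unitary (EuclideanSpace ℂ (Fin (d (π j))) →L[ℂ] EuclideanSpace ℂ (Fin (d (π j)))) :=
    fun j => Unitary.linearIsometryEquiv.symm ((L j).trans (E j).symm)
  let U := Equiv.piCongrLeft (fun k => unitary (EuclideanSpace ℂ (Fin (d k)) →L[ℂ]
    EuclideanSpace ℂ (Fin (d k)))) π U'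
  have hU : ∀ j, U (π j) = U' j := fun j => Equiv.piCongrLeft_apply_apply _ _ _ _
  refine ⟨π, hπ, U, fun x => funext fun j => ?_⟩
  rw [hval, hE, permConj, hU]
  change (E j).conjStarAlgEquiv (x (π j)) =
    (L j).conjStarAlgEquiv (star (U' j).1 * x (π j) * (U' j).1)
  have h1 : ∀ v, (U' j).1 v = (E j).symm (L j v) := fun v => rfl
  have h2 : ∀ v, star (U' j).1 v = (L j).symm (E j v) := by
    intro v
    have h3 : v = (U' j).1 ((L j).symm (E j v)) := by simp [h1]
    conv_lhs => rw [h3]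
    rw [← mul_apply_eq_comp, Unitary.coe_star_mul_self, one_apply_eq_self]
  ext1 v
  simp [h1, h2]

end Automorphism

/-! ### Corners of fixed points and the map `P₁₁`. -/

section Corner

variable {H : Type*} [NormedAddCommGroup H] [InnerProductSpace ℂ H] [FiniteDimensional ℂ H]
  [CompleteSpace H]

/-- The embedding `Y ↦ Y ⊕ 0` of `B(L)` into `B(H)`. -/
noncomputable def cornerEmbed (L : Submodule ℂ H) [CompleteSpace L] :
    (L →L[ℂ] L) →⋆ₙₐ[ℂ] (H →L[ℂ] H) where
  toFun Y := L.subtypeL ∘L Y ∘L L.orthogonalProjectionOnto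
  map_smul' c Y := by ext v; simp
  map_zero' := by ext v; simp
  map_add' Y Z := by ext v; simp
  map_mul' Y Z := by ext v; simp
  map_star' Y := by
    simp only [ContinuousLinearMap.star_eq_adjoint, ContinuousLinearMap.adjoint_comp,
      Submodule.adjoint_subtypeL, Submodule.adjoint_orthogonalProjectionOnto]
    rfl

variable (L : Submodule ℂ H) [CompleteSpace L]

omit [FiniteDimensional ℂ H] in
theorem cornerEmbed_apply (Y : L →L[ℂ] L) (v : H) :
    cornerEmbed L Y v = Y (L.orthogonalProjectionOnto v) := rfl

omit [FiniteDimensional ℂ H] in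
theorem conjAdjoint_subtypeL_apply (Z : H →L[ℂ] H) (v : L) :
    conjAdjoint L.subtypeL Z v = L.orthogonalProjectionOnto (Z v) := by
  change L.subtypeL.adjoint (Z v) = _
  rw [Submodule.adjoint_subtypeL]

omit [FiniteDimensional ℂ H] in
theorem coe_conjAdjoint_subtypeL_apply {Z : H →L[ℂ] H} {v : L} (h : Z v ∈ L) :
    (conjAdjoint L.subtypeL Z v : H) = Z v := by
  rw [conjAdjoint_subtypeL_apply]
  exact Submodule.starProjection_eq_self_iff.mpr h

omit [FiniteDimensional ℂ H] in
theorem conjAdjoint_one : conjAdjoint L.subtypeL (1 : H →L[ℂ] H) = 1 := by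
  ext v
  exact coe_conjAdjoint_subtypeL_apply L v.2

omit [FiniteDimensional ℂ H] in
theorem conjAdjoint_star (Z : H →L[ℂ] H) :
    conjAdjoint L.subtypeL (star Z) = star (conjAdjoint L.subtypeL Z) := by
  simp only [conjAdjoint, LinearMap.coe_mk, AddHom.coe_mk, ContinuousLinearMap.star_eq_adjoint,
    ContinuousLinearMap.adjoint_comp, ContinuousLinearMap.adjoint_adjoint]
  rfl

end Corner

section FixedPoints

variable {H : Type*} [NormedAddCommGroup H] [InnerProductSpace ℂ H] [FiniteDimensional ℂ H]
  [CompleteSpace H]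
  (P : (H →L[ℂ] H) →CP (H →L[ℂ] H)) (h1 : P 1 = 1) (hP : ∀ X, P (P X) = P X)
  {K : Submodule ℂ H} [CompleteSpace K] (hK : P K.starProjection = 0)
  (hfaithful : ∀ W : H →L[ℂ] H, P (star W * W) = 0 → ∀ x ∈ Kᗮ, W x = 0)
include h1 hP hK hfaithful

theorem eq_directSumOp_of_fixed {Z : H →L[ℂ] H} (hZ : P Z = Z) :
    Z = directSumOp K (conjAdjoint Kᗮ.subtypeL Z) (conjAdjoint K.subtypeL Z) := by
  ext v
  change Z v = (conjAdjoint Kᗮ.subtypeL Z (Kᗮ.orthogonalProjectionOnto v) : H) +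
    (conjAdjoint K.subtypeL Z (K.orthogonalProjectionOnto v) : H)
  rw [coe_conjAdjoint_subtypeL_apply _
      (apply_mem_orthogonal P h1 hP hK hfaithful hZ (Submodule.coe_mem _)),
    coe_conjAdjoint_subtypeL_apply _ (apply_mem P h1 hP hK hfaithful hZ (Submodule.coe_mem _)),
    ← map_add, add_comm]
  congr 1
  exact (K.starProjection_add_starProjection_orthogonal v).symm

-- The corner differs from `Z` only by `Q Z`, with `Q` the projection onto `K`, and `P` kills that
-- part. Thus `P` inverts compression on fixed points.
omit [FiniteDimensional ℂ H] in
theorem apply_cornerEmbed_conjAdjoint {Z : H →L[ℂ] H} (hZ : P Z = Z) :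
    P (cornerEmbed Kᗮ (conjAdjoint Kᗮ.subtypeL Z)) = Z := by
  have h : cornerEmbed Kᗮ (conjAdjoint Kᗮ.subtypeL Z) = Z - K.starProjection * Z := by
    ext v
    have hv := K.starProjection_add_starProjection_orthogonal v
    have e1 := apply_mem P h1 hP hK hfaithful hZ (K.starProjection_apply_mem v)
    have e2 := apply_mem_orthogonal P h1 hP hK hfaithful hZ (Kᗮ.starProjection_apply_mem v)
    rw [cornerEmbed_apply, sub_apply, mul_apply_eq_comp]
    refine (coe_conjAdjoint_subtypeL_apply _ e2).trans ?_
    change Z (Kᗮ.starProjection v) = _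
    conv_rhs => rw [← hv, map_add, map_add, Submodule.starProjection_eq_self_iff.mpr e1,
      (Submodule.starProjection_apply_eq_zero_iff K).mpr e2]
    abel
  rw [h, map_sub, apply_starProjection_mul P h1 hP hK hZ, hZ, sub_zero]

omit [FiniteDimensional ℂ H] in
theorem conjAdjoint_apply_mul {X Y : H →L[ℂ] H} (hX : P X = X) (hY : P Y = Y) :
    conjAdjoint Kᗮ.subtypeL (P (X * Y)) =
      conjAdjoint Kᗮ.subtypeL X * conjAdjoint Kᗮ.subtypeL Y := by
  ext v
  have hm : ∀ {Z}, P Z = Z → ∀ {x}, x ∈ Kᗮ → Z x ∈ Kᗮ := fun hZ _ hx =>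
    apply_mem_orthogonal P h1 hP hK hfaithful hZ hx
  rw [mul_apply_eq_comp, coe_conjAdjoint_subtypeL_apply _ (hm (hP _) v.2),
    coe_conjAdjoint_subtypeL_apply _ (hm hX (Submodule.coe_mem _)),
    coe_conjAdjoint_subtypeL_apply _ (hm hY v.2),
    apply_mul_eq_on_orthogonal P h1 hP hfaithful hX hY v.2]

/-- The fixed points of a unital completely positive idempotent, compressed to the space on which it
is faithful, form a star algebra. -/
noncomputable def compressedAlgebra : StarSubalgebra ℂ (Kᗮ →L[ℂ] Kᗮ) where
  carrier := {Y | ∃ Z, P Z = Z ∧ conjAdjoint Kᗮ.subtypeL Z = Y}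
  mul_mem' := by
    rintro _ _ ⟨X, hX, rfl⟩ ⟨Y, hY, rfl⟩
    exact ⟨P (X * Y), hP _, conjAdjoint_apply_mul P h1 hP hK hfaithful hX hY⟩
  add_mem' := by
    rintro _ _ ⟨X, hX, rfl⟩ ⟨Y, hY, rfl⟩
    exact ⟨X + Y, by rw [map_add, hX, hY], map_add _ _ _⟩
  algebraMap_mem' c := ⟨c • 1, by rw [map_smul, h1],
    by rw [map_smul, conjAdjoint_one, Algebra.algebraMap_eq_smul_one]⟩
  star_mem' := by
    rintro _ ⟨X, hX, rfl⟩
    exact ⟨star X, by rw [map_star, hX], conjAdjoint_star _ _⟩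

omit [FiniteDimensional ℂ H] in
theorem apply_cornerEmbed_of_mem {Y : Kᗮ →L[ℂ] Kᗮ}
    (hY : Y ∈ compressedAlgebra P h1 hP hK hfaithful) :
    conjAdjoint Kᗮ.subtypeL (P (cornerEmbed Kᗮ Y)) = Y := by
  obtain ⟨Z, hZ, rfl⟩ := hY
  rw [apply_cornerEmbed_conjAdjoint P h1 hP hK hfaithful hZ]

end FixedPoints

section Transient

variable {H : Type*} [NormedAddCommGroup H] [InnerProductSpace ℂ H] [FiniteDimensional ℂ H]
  [CompleteSpace H] (P : (H →L[ℂ] H) →CP (H →L[ℂ] H)) {K : Submodule ℂ H} [CompleteSpace K]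
  {M : ℕ} {d m : Fin M → ℕ} (W : BlockSpace d m ≃ₗᵢ[ℂ] Kᗮ)

/-- The map `X ↦ Q P(X ⊕ 0) Q` from `𝔄` to `B(K)`, with `Q` the projection onto `K`. -/
noncomputable def transientPart : blockAlgebra W →CP (K →L[ℂ] K) where
  toLinearMap := conjAdjoint K.subtypeL ∘ₗ P.toLinearMap ∘ₗ
    (cornerEmbed Kᗮ : (Kᗮ →L[ℂ] Kᗮ) →ₗ[ℂ] (H →L[ℂ] H)) ∘ₗ
      (blockAlgebra W).toSubalgebra.toSubmodule.subtype
  map_cstarMatrix_nonneg' k N hN := by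
    let ι : blockAlgebra W →⋆ₙₐ[ℂ] (H →L[ℂ] H) :=
      (cornerEmbed Kᗮ).comp ((blockAlgebra W).subtype : blockAlgebra W →⋆ₙₐ[ℂ] (Kᗮ →L[ℂ] Kᗮ))
    have h2 : 0 ≤ N.map ι := CompletelyPositiveMapClass.map_cstarMatrix_nonneg' ι k N hN
    exact map_conjAdjoint_nonneg K.subtypeL (P.map_cstarMatrix_nonneg' k _ h2)

theorem transientPart_apply (X : blockAlgebra W) :
    transientPart P W X = conjAdjoint K.subtypeL (P (cornerEmbed Kᗮ X)) := rfl

theorem transientPart_one (h1 : P 1 = 1) (hK : P K.starProjection = 0) :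
    transientPart P W 1 = 1 := by
  have h : cornerEmbed Kᗮ (1 : Kᗮ →L[ℂ] Kᗮ) = 1 - K.starProjection := by
    rw [← Submodule.starProjection_orthogonal']
    rfl
  rw [transientPart_apply]
  change conjAdjoint K.subtypeL (P (cornerEmbed Kᗮ (1 : Kᗮ →L[ℂ] Kᗮ))) = 1
  rw [h, map_sub, h1, hK, sub_zero, conjAdjoint_one]

end Transient

/-! ### The peripheral projection and the induced automorphism. -/

section Main

variable {H : Type*} [NormedAddCommGroup H] [InnerProductSpace ℂ H] [FiniteDimensional ℂ H]
  [CompleteSpace H]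

/-- The peripheral projection of a unital completely positive map is completely positive. -/
theorem exists_completelyPositive_peripheralProjection (Φ : (H →L[ℂ] H) →CP (H →L[ℂ] H))
    (hΦ : Φ 1 = 1) : ∃ (P : (H →L[ℂ] H) →CP (H →L[ℂ] H)) (F : Filter ℕ), F.NeBot ∧ F ≤ atTop ∧
      (∀ X, Tendsto (fun n => (Φ.toLinearMap ^ n) X) F (𝓝 (P X))) ∧ P 1 = 1 ∧
      (∀ X, P (P X) = P X) ∧ P.toLinearMap = peripheralProjection Φ.toLinearMap ∧
      (attractor Φ.toLinearMap : Set (H →L[ℂ] H)) = {Z | P Z = Z} := by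
  have hT : ∀ X, ‖Φ.toLinearMap X‖ ≤ ‖X‖ := norm_apply_le_of_unital Φ hΦ
  obtain ⟨F, hFne, hF, hlim⟩ := exists_tendsto_pow_peripheralProjection hT
  choose ψ hψ using exists_pow_completelyPositive Φ
  obtain ⟨P, hPT⟩ := exists_completelyPositive_of_tendsto (F := F) (φ := ψ)
    (T := peripheralProjection Φ.toLinearMap) fun X => by
      refine (hlim X).congr fun n => ?_
      rw [← hψ]; rfl
  have hPX : ∀ X, P X = peripheralProjection Φ.toLinearMap X := fun X =>
    congrArg (fun f : Module.End ℂ (H →L[ℂ] H) => f X) hPT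
  refine ⟨P, F, hFne, hF, fun X => ?_, ?_, fun X => ?_, hPT, Set.ext fun Z => ?_⟩
  · rw [hPX]; exact hlim X
  · rw [hPX]
    refine tendsto_nhds_unique (hlim 1) (tendsto_const_nhds.congr fun n => ?_)
    rw [Module.End.pow_apply]
    exact (Function.iterate_fixed hΦ n).symm
  · simp only [hPX, peripheralProjection_idem]
  · rw [SetLike.mem_coe, mem_attractor_iff hT, Set.mem_ofPred_eq, hPX]

set_option maxHeartbeats 600000 in
/-- The action of a unital completely positive map `Φ` on the range of an idempotent limit `P` of
its powers. -/
theorem exists_block_decomposition (Φ P : (H →L[ℂ] H) →CP (H →L[ℂ] H)) (hΦ : Φ 1 = 1)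
    (h1 : P 1 = 1) (hP : ∀ X, P (P X) = P X) {F : Filter ℕ} [F.NeBot] (hF : F ≤ atTop)
    (hlim : ∀ X, Tendsto (fun n => (Φ.toLinearMap ^ n) X) F (𝓝 (P X)))
    (K : Submodule ℂ H) [CompleteSpace K] (hK : P K.starProjection = 0)
    (hfaithful : ∀ W : H →L[ℂ] H, P (star W * W) = 0 → ∀ x ∈ Kᗮ, W x = 0) :
    ∃ (M : ℕ) (d m : Fin M → ℕ) (_ : ∀ k, 0 < d k ∧ 0 < m k) (W : BlockSpace d m ≃ₗᵢ[ℂ] Kᗮ)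
      (P₁₁ : blockAlgebra W →CP (K →L[ℂ] K)),
      P₁₁ 1 = 1 ∧
      {Z | P Z = Z} = {Z | ∃ X : blockAlgebra W, Z = directSumOp K X (P₁₁ X)} ∧
      ∃ (π : Equiv.Perm (Fin M)) (hπ : ∀ k, d k = d (π k))
        (U : ∀ k, unitary (EuclideanSpace ℂ (Fin (d k)) →L[ℂ] EuclideanSpace ℂ (Fin (d k)))),
        ∀ x : BlockFamily d, Φ (directSumOp K (blockElem W x) (P₁₁ (blockElem W x))) =
          directSumOp K (blockElem W (permConj π hπ U x))
            (P₁₁ (blockElem W (permConj π hπ U x))) := by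
  let 𝔄 := compressedAlgebra P h1 hP hK hfaithful
  obtain ⟨M, d, m, hdm, W, hW⟩ := exists_blockAlgebra_eq 𝔄
  let c := conjAdjoint Kᗮ.subtypeL
  let lift : (Kᗮ →L[ℂ] Kᗮ) → (H →L[ℂ] H) := fun Y => P (cornerEmbed Kᗮ Y)
  have hlift : ∀ Y, P (lift Y) = lift Y := fun Y => hP _
  have hc : ∀ X : blockAlgebra W, c (lift X) = X := fun X =>
    apply_cornerEmbed_of_mem P h1 hP hK hfaithful (hW ▸ X.2 : X.1 ∈ 𝔄)
  have hmem : ∀ Z, P Z = Z → c Z ∈ blockAlgebra W := fun Z hZ => by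
    rw [hW]; exact ⟨Z, hZ, rfl⟩
  have hliftc : ∀ Z, P Z = Z → lift (c Z) = Z := fun Z hZ =>
    apply_cornerEmbed_conjAdjoint P h1 hP hK hfaithful hZ
  have hsum : ∀ X : blockAlgebra W, directSumOp K X (transientPart P W X) = lift X := by
    intro X
    have := eq_directSumOp_of_fixed P h1 hP hK hfaithful (hlift X)
    rw [this, transientPart_apply]
    congr 1
    exact (hc X).symm
  have hbe : ∀ x, c (lift (blockEmbed W x)) = blockEmbed W x := fun x => hc (blockElem W x)
  have hΦfix : ∀ Z, P Z = Z → P (Φ Z) = Φ Z := fun Z hZ => by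
    rw [apply_apply_comm Φ P hlim hΦ, hZ]
  have hinj : Function.Injective (blockEmbed W) := blockEmbed_injective (fun k => (hdm k).2) W
  have hex : ∀ x, ∃ y, blockEmbed W y = c (Φ (lift (blockEmbed W x))) := fun x =>
    hmem _ (hΦfix _ (hlift _))
  choose α₀ hα₀ using hex
  have lift_one : lift 1 = 1 := by
    have := hliftc 1 h1
    rwa [show c 1 = 1 from conjAdjoint_one _] at this
  let α : BlockFamily d →⋆ₐ[ℂ] BlockFamily d :=
    { toFun := α₀
      map_one' := hinj (by
        rw [hα₀, map_one, lift_one, hΦ]; exact conjAdjoint_one _)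
      map_mul' := fun x y => hinj (by
        -- The product of 𝔄 corresponds on fixed points to the Choi-Effros product `P (X Y)`, not to
        -- the operator product on `H`.
        have e : lift (blockEmbed W x * blockEmbed W y) =
            P (lift (blockEmbed W x) * lift (blockEmbed W y)) := by
          rw [← hliftc (P _) (hP _)]
          congr 1
          refine Eq.trans ?_ (conjAdjoint_apply_mul P h1 hP hK hfaithful (hlift _) (hlift _)).symm
          exact congrArg₂ _ (hbe x).symm (hbe y).symm
        rw [hα₀, map_mul, map_mul, hα₀, hα₀, e, ← apply_apply_comm Φ P hlim hΦ,
          apply_mul_of_fixed Φ P hF hlim hΦ hP (hlift _) (hlift _)]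
        exact conjAdjoint_apply_mul P h1 hP hK hfaithful (hΦfix _ (hlift _)) (hΦfix _ (hlift _)))
      map_zero' := hinj (by
        rw [hα₀]; simp [lift])
      map_add' := fun x y => hinj (by
        rw [hα₀, map_add, map_add, hα₀, hα₀]; simp [lift])
      commutes' := fun r => hinj (by
        rw [hα₀, Algebra.algebraMap_eq_smul_one, map_smul, map_one]
        have : lift (r • 1) = r • lift 1 := by simp [lift]
        rw [this, lift_one, map_smul, hΦ, map_smul]
        congr 1
        exact conjAdjoint_one _)
      map_star' := fun x => hinj (by
        have : lift (star (blockEmbed W x)) = star (lift (blockEmbed W x)) := by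
          simp only [lift, map_star]
        rw [hα₀, map_star, map_star, hα₀, this, map_star]
        exact conjAdjoint_star _ _) }
  have hα : ∀ x, blockEmbed W (α x) = c (Φ (lift (blockEmbed W x))) := hα₀
  have hαinj : Function.Injective α := by
    rw [injective_iff_map_eq_zero]
    intro x hx
    have e1 := hα x
    rw [hx, map_zero] at e1
    have e2 := hliftc _ (hΦfix _ (hlift (blockEmbed W x)))
    rw [← e1] at e2
    have e3 : Φ (lift (blockEmbed W x)) = 0 := by rw [← e2]; simp [lift]
    -- `Φ` is injective on fixed points of `P`: they are limits of their own iterates.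
    have e4 := eq_zero_of_apply_eq_zero Φ P hF hlim (hlift _) e3
    refine hinj ?_
    rw [map_zero, ← hbe x, e4, map_zero]
  obtain ⟨π, hπ, U, hU⟩ := exists_eq_permConj (fun k => (hdm k).1) α hαinj
  refine ⟨M, d, m, hdm, W, transientPart P W, transientPart_one P W h1 hK,
    Set.ext fun Z => ⟨fun hZ => ?_, ?_⟩, π, hπ, U, fun x => ?_⟩
  · refine ⟨⟨c Z, hmem Z hZ⟩, ?_⟩
    rw [hsum]
    exact (hliftc Z hZ).symm
  · rintro ⟨X, rfl⟩
    rw [Set.mem_ofPred_eq, hsum, hlift]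
  · rw [hsum, hsum, ← hU]
    change Φ (lift (blockEmbed W x)) = lift (blockEmbed W (α x))
    rw [hα, hliftc _ (hΦfix _ (hlift _))]

end Main

end Asymptotics.UCP

open Asymptotics.UCP
set_option maxHeartbeats 600000 in
theorem theorem3p1 {H : Type*} [NormedAddCommGroup H] [InnerProductSpace ℂ H]
    [FiniteDimensional ℂ H] [CompleteSpace H]
    (Φ : (H →L[ℂ] H) →CP (H →L[ℂ] H)) (hΦ : Φ 1 = 1) :
    ∃ (M : ℕ) (d m : Fin M → ℕ) (_ : ∀ k, 0 < d k ∧ 0 < m k)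
      (W : BlockSpace d m ≃ₗᵢ[ℂ] (transientSpace Φ.toLinearMap)ᗮ)
      (P₁₁ : blockAlgebra W →CP
        (transientSpace Φ.toLinearMap →L[ℂ] transientSpace Φ.toLinearMap)),
      P₁₁ 1 = 1 ∧
      (attractor Φ.toLinearMap : Set (H →L[ℂ] H)) =
        {Z | ∃ X : blockAlgebra W, Z = directSumOp (transientSpace Φ.toLinearMap) X (P₁₁ X)} ∧
      ∃ (π : Equiv.Perm (Fin M)) (hπ : ∀ k, d k = d (π k))
        (U : ∀ k, unitary (EuclideanSpace ℂ (Fin (d k)) →L[ℂ] EuclideanSpace ℂ (Fin (d k)))),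
        ∀ x : BlockFamily d,
          Φ (directSumOp (transientSpace Φ.toLinearMap) (blockElem W x) (P₁₁ (blockElem W x))) =
            directSumOp (transientSpace Φ.toLinearMap) (blockElem W (permConj π hπ U x))
              (P₁₁ (blockElem W (permConj π hπ U x))) := by
  obtain ⟨P, F, hFne, hF, hlim, h1, hP, hPT, hattr⟩ :=
    exists_completelyPositive_peripheralProjection Φ hΦ
  have hK : transientSpace Φ.toLinearMap = (hsAdjoint P.toLinearMap 1).ker := by
    rw [hPT]; rfl
  rw [hattr]
  exact exists_block_decomposition Φ P hΦ h1 hP hF hlim (transientSpace Φ.toLinearMap)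
    (by simp only [hK]; exact apply_starProjection_ker_hsAdjoint P)
    (fun W hW x hx => apply_eq_zero_of_apply_star_mul_self P hW (hK ▸ hx))
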